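/- Let $n,m\ge 1$ and let $\mathbb H=\{z=(x,t): x\in\mathbb R^n,\ t>0\}\subset\mathbb R^{n+1}$ be the upper half space. Let $\{\Delta_k\}_{k=1}^\infty$ be a Whitney decomposition of $\mathbb H$: closed cubes with sides parallel to the coordinate axes and pairwise disjoint interiors, with $\bigcup_k\Delta_k=\mathbb H$ and $\operatorname{diam}\Delta_k\asymp\operatorname{dist}(\Delta_k,\partial\mathbb H)$ uniformly in $k$. Let $(\xi_k,\eta_k)\in\mathbb R^n\times(0,\infty)$ be the centre of $\Delta_k$. For $0<s<\infty$ and $\beta>-1$ let $A(s,\beta)$ be the space of all harmonic functions $f$ on $\mathbb H$ with $$\|f\|_{A(s,\beta)}=\Big(\int_{\mathbb H}|f(x,t)|^s\,t^{\beta}\,dx\,dt\Big)^{1/s}<\infty .$$ For $0<p,q<\infty$, a positive Borel measure $\mu$ on $\mathbb H$ and harmonic functions $f_1,\dots,f_m$ on $\mathbb H$ put $$\|(f_1,\dots,f_m)\|_{A(p,q,m,d\mu)}=\Big(\sum_{k=1}^\infty\Big(\int_{\Delta_k}\prod_{i=1}^m|f_i(z)|^p\,d\mu(z)\Big)^{q/p}\Big)^{1/q}\in[0,\infty].$$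 **Theorem.** Let $0<p,q<\infty$, $0<s\le q$, $\beta_i>-1$ for $i=1,\dots,m$, and let $\mu$ be a positive Borel measure on $\mathbb H$. Then the following conditions are equivalent. 1. There is a constant $C<\infty$ such that, for all $f_i\in A(s,\beta_i)$, $i=1,\dots,m$, $$\|(f_1,\dots,f_m)\|_{A(p,q,m,d\mu)}\le C\prod_{i=1}^m\|f_i\|_{A(s,\beta_i)} .$$ 2. There is a constant $C<\infty$ such that $$\mu(\Delta_k)\le C\,\eta_k^{\sum_{i=1}^m p(n+1+\beta_i)/s}\qquad\text{for all } k\ge 1 .$$ -/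

import Mathlib

open MeasureTheory
open scoped ENNReal NNReal

noncomputable section

/-- The open upper half space in `ℝ^{n+1}`; a point is `z = (x, t)`, where the height `t` is the
last coordinate. -/
def upperHalfSpace (n : ℕ) : Set (EuclideanSpace ℝ (Fin (n + 1))) :=
  {z | 0 < z (Fin.last n)}

/-- The closed cube with sides parallel to the coordinate axes, centre `c` and side length `l`. -/
def closedCube {n : ℕ} (c : EuclideanSpace ℝ (Fin (n + 1))) (l : ℝ) :
    Set (EuclideanSpace ℝ (Fin (n + 1))) :=
  {z | ∀ i, |z i - c i| ≤ l / 2}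

/-- The distance between two sets, as an extended nonnegative real number. -/
def setEDist {E : Type*} [PseudoEMetricSpace E] (A B : Set E) : ℝ≥0∞ :=
  ⨅ x ∈ A, ⨅ y ∈ B, edist x y

/-- The cubes with centres `ζ k` and side lengths `l k` form a Whitney decomposition of the
upper half space: they are nondegenerate closed cubes with union the half space and with pairwise
disjoint interiors, and their diameters are comparable, uniformly in `k`, to their distances from
the boundary of the half space. -/
structure IsWhitneyDecomposition {n : ℕ} (ζ : ℕ → EuclideanSpace ℝ (Fin (n + 1)))
    (l : ℕ → ℝ) : Prop where
  side_pos : ∀ k, 0 < l k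
  iUnion_eq : ⋃ k, closedCube (ζ k) (l k) = upperHalfSpace n
  disjoint_interior : ∀ j k, j ≠ k →
    Disjoint (interior (closedCube (ζ j) (l j))) (interior (closedCube (ζ k) (l k)))
  diam_comparable : ∃ c C : ℝ≥0, 0 < c ∧ ∀ k,
    c * setEDist (closedCube (ζ k) (l k)) (frontier (upperHalfSpace n))
        ≤ Metric.ediam (closedCube (ζ k) (l k)) ∧
      Metric.ediam (closedCube (ζ k) (l k))
        ≤ C * setEDist (closedCube (ζ k) (l k)) (frontier (upperHalfSpace n))

/-- The (quasi-)norm `(∫ |f(x,t)|^s t^β dx dt)^{1/s}`, over the upper half space, with values in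
`[0, ∞]`. -/
def bergmanNorm {n : ℕ} {𝕜 : Type*} [RCLike 𝕜] (s β : ℝ)
    (f : EuclideanSpace ℝ (Fin (n + 1)) → 𝕜) : ℝ≥0∞ :=
  (∫⁻ z in upperHalfSpace n, ‖f z‖ₑ ^ s * ENNReal.ofReal (z (Fin.last n) ^ β)) ^ (1 / s)

/-- Membership in the weighted harmonic Bergman space `A(s, β)`. -/
def MemBergman {n : ℕ} {𝕜 : Type*} [RCLike 𝕜] (s β : ℝ)
    (f : EuclideanSpace ℝ (Fin (n + 1)) → 𝕜) : Prop :=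
  InnerProductSpace.HarmonicOnNhd f (upperHalfSpace n) ∧ bergmanNorm s β f < ∞

/-- The (quasi-)norm of an `m`-tuple in `A(p, q, m, dμ)`, with values in `[0, ∞]`, relative to the
cubes with centres `ζ k` and side lengths `l k`. -/
def multiNorm {n m : ℕ} {𝕜 : Type*} [RCLike 𝕜] (ζ : ℕ → EuclideanSpace ℝ (Fin (n + 1)))
    (l : ℕ → ℝ) (p q : ℝ) (μ : Measure (EuclideanSpace ℝ (Fin (n + 1))))
    (f : Fin m → EuclideanSpace ℝ (Fin (n + 1)) → 𝕜) : ℝ≥0∞ :=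
  (∑' k, (∫⁻ z in closedCube (ζ k) (l k), ∏ i, ‖f i z‖ₑ ^ p ∂μ) ^ (q / p)) ^ (1 / q)

end

/-! ### Weighted mean values of harmonic functions over balls -/

section MeanValue

open InnerProductSpace Laplacian Topology Metric

/-! Condition 2 implies condition 1 by a local estimate followed by a summation. On a Whitney cube
`|f_i|^s` is at most a constant times `η_k^{-(n+1+β_i)}` times the integral of `|f_i|^s t^{β_i}`
over an enlarged cube (`exists_enorm_rpow_le_setLIntegral_cubeNhd`). Raising this to the power
`p/s`, multiplying over `i` and integrating against `μ`, the powers of `η_k` are exactly compensated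
by the hypothesis on `μ(Δ_k)`. What remains is a sum over `k` of products of local integrals to the
power `q/s ≥ 1`. It is controlled by the product of the full sums (`ENNReal.tsum_prod_rpow_le`), and
the enlarged cubes overlap boundedly (`IsWhitneyDecomposition.exists_tsum_indicator_le`).

The local estimate rests on a mean value inequality for `|f|^s` valid for every `s > 0`
(`exists_enorm_rpow_le`). The case `s = 1` comes from a weighted mean value identity, `s > 1` from
Jensen's inequality, and `s < 1` from a maximum argument that absorbs `|f|^{1-s}`.

Conversely, condition 1 is tested on one function per cube and index (`exists_memBergman_one_le`):
the real part of the Kelvin transform of `(t + i x₁)^{k+2}`, with its pole below the boundary at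
depth comparable to `η`. A large degree makes it decay fast enough to be in the Bergman space, a
deep pole keeps its real part positive on the cube, and scaling gives the power of `η` in its norm.
Keeping only the term of that cube in the sum yields condition 2. -/

lemma hasDerivAt_max_zero_sq (x : ℝ) :
    HasDerivAt (fun x : ℝ => (max x 0) ^ 2) (2 * max x 0) x := by
  rcases lt_trichotomy x 0 with h | h | h
  · rw [max_eq_right h.le, mul_zero]
    refine (hasDerivAt_const x (0 : ℝ)).congr_of_eventuallyEq ?_
    filter_upwards [gt_mem_nhds h] with y hy
    simp [max_eq_right (le_of_lt hy)]
  · subst h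
    rw [max_self, mul_zero]
    rw [hasDerivAt_iff_isLittleO]
    have : (fun h : ℝ => h ^ 2) =o[𝓝 0] fun h => h := by
      simpa using Asymptotics.isLittleO_pow_id (𝕜 := ℝ) (n := 2) (by norm_num)
    simp only [sub_zero, smul_zero, max_self]
    refine (Asymptotics.isBigO_of_le _ fun y => ?_).trans_isLittleO this
    rcases le_total y 0 with hy | hy <;> simp [hy, sq_nonneg]
  · rw [max_eq_left h.le]
    have := hasDerivAt_pow 2 x
    refine HasDerivAt.congr_of_eventuallyEq (by simpa using this) ?_
    filter_upwards [lt_mem_nhds h] with y hy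
    simp [max_eq_left (le_of_lt hy)]

section Weight

variable {E : Type*} [NormedAddCommGroup E]

/-- The radial weight `(1 - ‖w‖²)₊`. -/
def radialWeight (w : E) : ℝ := max (1 - ‖w‖ ^ 2) 0

lemma radialWeight_nonneg (w : E) : 0 ≤ radialWeight w := le_max_right _ _

lemma radialWeight_le_one (w : E) : radialWeight w ≤ 1 :=
  max_le (by nlinarith [sq_nonneg ‖w‖]) zero_le_one

lemma continuous_radialWeight : Continuous (radialWeight : E → ℝ) := by
  unfold radialWeight; fun_prop

lemma radialWeight_eq_zero {w : E} (hw : w ∉ closedBall (0 : E) 1) : radialWeight w = 0 := by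
  rw [mem_closedBall_zero_iff, not_le] at hw
  exact max_eq_right (by nlinarith)

lemma add_smul_mem_ball [NormedSpace ℝ E] {z w : E} {r R : ℝ} (hr : |r| < R)
    (hw : w ∈ closedBall (0 : E) 1) : z + r • w ∈ ball z R := by
  rw [mem_closedBall_zero_iff] at hw
  rw [mem_ball_iff_norm, add_sub_cancel_left, norm_smul, Real.norm_eq_abs]
  nlinarith [abs_nonneg r]

lemma integrable_of_continuousOn_closedBall [NormedSpace ℝ E] [FiniteDimensional ℝ E]
    [MeasureSpace E] [BorelSpace E] [IsFiniteMeasureOnCompacts (volume : Measure E)]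
    {F : Type*} [NormedAddCommGroup F] {h : E → F}
    (hc : ContinuousOn h (closedBall 0 1)) (h0 : ∀ w ∉ closedBall (0 : E) 1, h w = 0) :
    Integrable h := by
  have := hc.integrableOn_compact (μ := volume) (isCompact_closedBall (0 : E) 1)
  rwa [integrableOn_iff_integrable_of_support_subset] at this
  intro w hw
  by_contra hn
  exact hw (h0 w hn)

end Weight

variable {E : Type*} [NormedAddCommGroup E] [InnerProductSpace ℝ E]

/-- The weight itself has a corner on the unit sphere, but its square is differentiable everywhere.
Its gradient is `-4` times the weight times `w`, so a weighted radial derivative becomes a pairing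
with the gradient of a compactly supported function. -/
lemma hasFDerivAt_radialWeight_sq (w : E) :
    HasFDerivAt (fun w : E => radialWeight w ^ 2)
      ((-4 * radialWeight w) • innerSL ℝ w) w := by
  have h1 : HasFDerivAt (fun w : E => 1 - ‖w‖ ^ 2) (-(2 • innerSL ℝ w)) w :=
    (hasStrictFDerivAt_norm_sq w).hasFDerivAt.const_sub 1
  have h2 := (hasDerivAt_max_zero_sq (1 - ‖w‖ ^ 2)).comp_hasFDerivAt w h1
  refine HasFDerivAt.congr_fderiv h2 ?_
  ext v
  simp [radialWeight]
  ring

variable [FiniteDimensional ℝ E] [MeasurableSpace E] [BorelSpace E]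
variable {F : Type*} [NormedAddCommGroup F] [NormedSpace ℝ F]

/-- With `Φ` the square of the weight, the integrand is `-1/4` times the pairing of `∇Φ` with `∇f`.
Integration by parts moves the derivative onto `∇f(z + r w)`, which gives `r Δf = 0`. -/
lemma integral_radialWeight_smul_fderiv_eq_zero [CompleteSpace F] {f : E → F} {z : E} {R r : ℝ}
    (hf : HarmonicOnNhd f (ball z R)) (hr : |r| < R) :
    ∫ w, radialWeight w • fderiv ℝ f (z + r • w) w = 0 := by
  set b := stdOrthonormalBasis ℝ E
  have hfd : ∀ y ∈ ball z R, ContDiffAt ℝ 1 (fderiv ℝ f) y := fun y hy =>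
    (hf y hy).1.fderiv_right (by norm_num)
  have hline : ∀ w : E, HasFDerivAt (fun w : E => z + r • w) (r • ContinuousLinearMap.id ℝ E) w :=
    fun w => ((hasFDerivAt_id w).const_smul r).const_add z
  have hg : ∀ w ∈ closedBall (0 : E) 1, ∀ v : E,
      HasFDerivAt (fun w => fderiv ℝ f (z + r • w) v)
        (r • (fderiv ℝ (fderiv ℝ f) (z + r • w)).flip v) w := by
    intro w hw v
    have h1 := ((hfd _ (add_smul_mem_ball hr hw)).differentiableAt (by norm_num)).hasFDerivAt
    have h2 := (h1.comp w (hline w)).clm_apply (hasFDerivAt_const v w)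
    refine HasFDerivAt.congr_fderiv h2 ?_
    ext u
    simp
  have hcg : ∀ v : E, ContinuousOn (fun w => fderiv ℝ f (z + r • w) v) (closedBall 0 1) :=
    fun v w hw => (hg w hw v).continuousAt.continuousWithinAt
  have hcg' : ∀ v : E,
      ContinuousOn (fun w => fderiv ℝ (fun w => fderiv ℝ f (z + r • w) v) w v)
        (closedBall 0 1) := by
    intro v
    have : ContinuousOn (fun w => r • fderiv ℝ (fderiv ℝ f) (z + r • w) v v)
        (closedBall 0 1) := by
      intro w hw
      have h1 : ContinuousAt (fderiv ℝ (fderiv ℝ f)) (z + r • w) :=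
        ((hfd _ (add_smul_mem_ball hr hw)).fderiv_right (m := 0) (by norm_num)).continuousAt
      have h2 : ContinuousAt (fun w => fderiv ℝ (fderiv ℝ f) (z + r • w)) w :=
        h1.comp (f := fun w => z + r • w) (hline w).continuousAt
      exact (((h2.clm_apply continuousAt_const).clm_apply
        continuousAt_const).const_smul r).continuousWithinAt
    refine this.congr fun w hw => ?_
    rw [(hg w hw v).fderiv]
    simp
  have hts : tsupport (fun w : E => radialWeight w ^ 2) ⊆ closedBall 0 1 := by
    refine closure_minimal (fun w hw => ?_) isClosed_closedBall
    by_contra hn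
    exact hw (by simp [radialWeight_eq_zero hn])
  have hΦ : ∀ w v : E, fderiv ℝ (fun w : E => radialWeight w ^ 2) w v
      = -4 * radialWeight w * inner ℝ w v := fun w v => by
    rw [(hasFDerivAt_radialWeight_sq w).fderiv]; simp
  have hI1 : ∀ v : E, Integrable (fun w : E =>
      fderiv ℝ (fun w : E => radialWeight w ^ 2) w v • fderiv ℝ f (z + r • w) v) := by
    intro v
    refine integrable_of_continuousOn_closedBall ?_ fun w hw => ?_
    · simp_rw [hΦ]
      refine ContinuousOn.smul ?_ (hcg v)
      have := continuous_radialWeight (E := E)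
      fun_prop
    · simp [hΦ, radialWeight_eq_zero hw]
  have hibp : ∀ v : E, ∫ w : E,
      fderiv ℝ (fun w : E => radialWeight w ^ 2) w v • fderiv ℝ f (z + r • w) v =
      - ∫ w : E, (radialWeight w ^ 2) • fderiv ℝ (fun w => fderiv ℝ f (z + r • w) v) w v := by
    intro v
    rw [integral_smul_fderiv_eq_neg_fderiv_smul_of_integrable (hI1 v), neg_neg]
    · refine integrable_of_continuousOn_closedBall ?_ fun w hw => ?_
      · exact (continuous_radialWeight.pow 2).continuousOn.smul (hcg' v)
      · simp [radialWeight_eq_zero hw]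
    · refine integrable_of_continuousOn_closedBall ?_ fun w hw => ?_
      · exact (continuous_radialWeight.pow 2).continuousOn.smul (hcg v)
      · simp [radialWeight_eq_zero hw]
    · exact fun w _ => (hasFDerivAt_radialWeight_sq w).differentiableAt
    · exact fun w hw => (hg w (hts hw) v).differentiableAt
  have hI2 : ∀ v : E, Integrable (fun w : E =>
      (radialWeight w ^ 2) • fderiv ℝ (fun w => fderiv ℝ f (z + r • w) v) w v) := by
    intro v
    refine integrable_of_continuousOn_closedBall ?_ fun w hw => ?_
    · exact (continuous_radialWeight.pow 2).continuousOn.smul (hcg' v)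
    · simp [radialWeight_eq_zero hw]
  have hdecomp : ∀ w : E, radialWeight w • fderiv ℝ f (z + r • w) w =
      (-(1 / 4) : ℝ) • ∑ i, fderiv ℝ (fun w : E => radialWeight w ^ 2) w (b i) •
        fderiv ℝ f (z + r • w) (b i) := by
    intro w
    have hw : fderiv ℝ f (z + r • w) w =
        fderiv ℝ f (z + r • w) (∑ i, inner ℝ (b i) w • b i) :=
      congrArg _ (b.sum_repr' w).symm
    rw [hw, map_sum, Finset.smul_sum, Finset.smul_sum]
    refine Finset.sum_congr rfl fun i _ => ?_
    rw [hΦ, map_smul, smul_smul, smul_smul, real_inner_comm]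
    congr 1
    ring
  simp_rw [hdecomp]
  rw [integral_smul, integral_finsetSum _ fun i _ => hI1 (b i)]
  simp_rw [hibp]
  rw [Finset.sum_neg_distrib, ← integral_finsetSum _ fun i _ => hI2 (b i)]
  have hz : ∀ w : E, ∑ i, (radialWeight w ^ 2) •
      fderiv ℝ (fun w => fderiv ℝ f (z + r • w) (b i)) w (b i) = 0 := by
    intro w
    by_cases hw : w ∈ closedBall (0 : E) 1
    · rw [← Finset.smul_sum]
      have hL := (hf _ (add_smul_mem_ball hr hw)).2.self_of_nhds
      rw [laplacian_eq_iteratedFDeriv_orthonormalBasis f b] at hL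
      simp only [iteratedFDeriv_two_apply, Pi.zero_apply] at hL
      have : ∑ i, fderiv ℝ (fun w => fderiv ℝ f (z + r • w) (b i)) w (b i) = 0 := by
        rw [← smul_zero r, ← hL, Finset.smul_sum]
        refine Finset.sum_congr rfl fun i _ => ?_
        rw [(hg w hw (b i)).fderiv]
        simp
      rw [this, smul_zero]
    · simp [radialWeight_eq_zero hw]
  simp [hz]

/-- The weighted mean value property of harmonic functions. -/
theorem integral_radialWeight_smul_eq [CompleteSpace F] {f : E → F} {z : E} {R r : ℝ}
    (hf : HarmonicOnNhd f (ball z R)) (hr : |r| < R) :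
    ∫ w, radialWeight w • f (z + r • w) = (∫ w : E, radialWeight w) • f z := by
  have hR : 0 < R := (abs_nonneg r).trans_lt hr
  have hcont : ∀ ρ : ℝ, |ρ| < R →
      ContinuousOn (fun w => f (z + ρ • w)) (closedBall 0 1) := fun ρ hρ =>
    hf.continuousOn.comp (by fun_prop) fun w hw => add_smul_mem_ball hρ hw
  have hfd : ContinuousOn (fderiv ℝ f) (ball z R) := fun y hy =>
    ((hf y hy).1.fderiv_right (m := 1) (by norm_num)).continuousAt.continuousWithinAt
  have hcont' : ∀ ρ : ℝ, |ρ| < R →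
      ContinuousOn (fun w => fderiv ℝ f (z + ρ • w) w) (closedBall 0 1) := fun ρ hρ =>
    (hfd.comp (by fun_prop) fun w hw => add_smul_mem_ball hρ hw).clm_apply continuousOn_id
  -- Differentiation under the integral produces the radial derivative integral, which vanishes. The
  -- domination comes from a bound on `∇f` over an intermediate closed ball of radius `T`.
  have key : ∀ ρ ∈ ball (0 : ℝ) R,
      HasDerivAt (fun ρ => ∫ w, radialWeight w • f (z + ρ • w)) 0 ρ := by
    intro ρ hρ
    rw [mem_ball_zero_iff, Real.norm_eq_abs] at hρ
    obtain ⟨T, hT, hTR⟩ := exists_between hρ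
    obtain ⟨M, hM⟩ : ∃ M, ∀ y ∈ closedBall z T, ‖fderiv ℝ f y‖ ≤ M :=
      (isCompact_closedBall z T).exists_bound_of_continuousOn
        (hfd.mono (closedBall_subset_ball hTR))
    have hD := hasDerivAt_integral_of_dominated_loc_of_deriv_le (μ := (volume : Measure E))
      (s := ball 0 T) (x₀ := ρ)
      (F := fun ρ w => radialWeight w • f (z + ρ • w))
      (F' := fun ρ w => radialWeight w • fderiv ℝ f (z + ρ • w) w)
      (bound := (closedBall (0 : E) 1).indicator fun _ => M)
      (isOpen_ball.mem_nhds (by simpa using hT)) ?_ ?_ ?_ ?_ ?_ ?_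
    · rw [integral_radialWeight_smul_fderiv_eq_zero hf hρ] at hD
      exact hD.2
    · filter_upwards [isOpen_ball.mem_nhds (show ρ ∈ ball (0 : ℝ) R by simpa using hρ)] with x hx
      refine (integrable_of_continuousOn_closedBall
        (continuous_radialWeight.continuousOn.smul (hcont x (by simpa using hx)))
        fun w hw => ?_).aestronglyMeasurable
      simp [radialWeight_eq_zero hw]
    · refine integrable_of_continuousOn_closedBall
        (continuous_radialWeight.continuousOn.smul (hcont ρ hρ)) fun w hw => ?_
      simp [radialWeight_eq_zero hw]
    · refine (integrable_of_continuousOn_closedBall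
        (continuous_radialWeight.continuousOn.smul (hcont' ρ hρ))
        fun w hw => ?_).aestronglyMeasurable
      simp [radialWeight_eq_zero hw]
    · refine Filter.Eventually.of_forall fun w x hx => ?_
      rw [mem_ball_zero_iff, Real.norm_eq_abs] at hx
      by_cases hw : w ∈ closedBall (0 : E) 1
      · rw [Set.indicator_of_mem hw, norm_smul, Real.norm_of_nonneg (radialWeight_nonneg w)]
        have h1 := hM _ (ball_subset_closedBall (add_smul_mem_ball (z := z) hx hw))
        have h2 := (fderiv ℝ f (z + x • w)).le_opNorm w
        have h3 := radialWeight_le_one w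
        have h4 := radialWeight_nonneg w
        rw [mem_closedBall_zero_iff] at hw
        have h5 : ‖fderiv ℝ f (z + x • w) w‖ ≤ M :=
          h2.trans ((mul_le_of_le_one_right (norm_nonneg _) hw).trans h1)
        exact (mul_le_of_le_one_left (norm_nonneg _) h3).trans h5
      · simp [radialWeight_eq_zero hw, Set.indicator_of_notMem hw]
    · refine (integrable_indicator_iff measurableSet_closedBall).2 ?_
      exact integrableOn_const (measure_closedBall_lt_top).ne
    · refine Filter.Eventually.of_forall fun w x hx => ?_
      rw [mem_ball_zero_iff, Real.norm_eq_abs] at hx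
      by_cases hw : w ∈ closedBall (0 : E) 1
      · have h1 := ((hf _ (add_smul_mem_ball (hx.trans hTR) hw)).1.differentiableAt
          (by norm_num)).hasFDerivAt
        have h2 : HasDerivAt (fun x : ℝ => z + x • w) w x := by
          simpa using ((hasDerivAt_id x).smul_const w).const_add z
        exact (h1.comp_hasDerivAt x h2).const_smul _
      · simpa [radialWeight_eq_zero hw] using hasDerivAt_const x (0 : F)
  -- The weighted mean is thus independent of the radius. At radius zero it is `f z` times the total
  -- weight.
  have hconst := (convex_ball (0 : ℝ) R).is_const_of_fderivWithin_eq_zero (𝕜 := ℝ)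
    (f := fun ρ => ∫ w, radialWeight w • f (z + ρ • w))
    (fun ρ hρ => (key ρ hρ).differentiableAt.differentiableWithinAt)
    (fun ρ hρ => by
      rw [fderivWithin_of_isOpen isOpen_ball hρ, (key ρ hρ).hasFDerivAt.fderiv]
      ext; simp)
    (show r ∈ ball (0 : ℝ) R by simpa using hr) (show (0 : ℝ) ∈ ball (0 : ℝ) R by simpa using hR)
  simp only [zero_smul, add_zero] at hconst
  rw [hconst, integral_smul_const]

lemma integral_radialWeight_pos : 0 < ∫ w : E, radialWeight w := by
  have hI : Integrable (radialWeight : E → ℝ) :=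
    integrable_of_continuousOn_closedBall continuous_radialWeight.continuousOn
      fun w hw => radialWeight_eq_zero hw
  refine continuous_radialWeight.integral_pos_of_hasCompactSupport_nonneg_nonzero ?_
    radialWeight_nonneg (x := 0) (by simp [radialWeight])
  exact HasCompactSupport.intro (isCompact_closedBall (0 : E) 1)
    fun w hw => radialWeight_eq_zero hw

lemma lintegral_comp_add_smul (g : E → ℝ≥0∞) (z : E) {r : ℝ} (hr : 0 < r) :
    ∫⁻ w, g (z + r • w) = ENNReal.ofReal (r ^ Module.finrank ℝ E)⁻¹ * ∫⁻ w, g w := by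
  have h1 : ∫⁻ w, g (z + r • w) = ∫⁻ w, g (z + w) ∂(Measure.map (r • ·) (volume : Measure E)) :=
    (lintegral_map_equiv (fun w => g (z + w))
      (Homeomorph.smulOfNeZero r hr.ne').toMeasurableEquiv).symm
  rw [h1, Measure.map_addHaar_smul _ hr.ne', lintegral_smul_measure, smul_eq_mul,
    lintegral_add_left_eq_self, abs_of_pos (by positivity)]

lemma setLIntegral_comp_add_smul_closedBall (g : E → ℝ≥0∞) (z : E) {r : ℝ} (hr : 0 < r) :
    ∫⁻ w in closedBall 0 1, g (z + r • w) =
      ENNReal.ofReal (r ^ Module.finrank ℝ E)⁻¹ * ∫⁻ w in closedBall z r, g w := by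
  rw [← lintegral_indicator measurableSet_closedBall,
    ← lintegral_indicator measurableSet_closedBall, ← lintegral_comp_add_smul _ z hr]
  refine lintegral_congr fun w => ?_
  have : w ∈ closedBall (0 : E) 1 ↔ z + r • w ∈ closedBall z r := by
    rw [mem_closedBall_zero_iff, mem_closedBall_iff_norm, add_sub_cancel_left, norm_smul,
      Real.norm_of_nonneg hr.le, mul_le_iff_le_one_right hr]
  by_cases hw : w ∈ closedBall (0 : E) 1
  · rw [Set.indicator_of_mem hw, Set.indicator_of_mem (this.1 hw)]
  · rw [Set.indicator_of_notMem hw, Set.indicator_of_notMem (fun h => hw (this.2 h))]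

variable (E F) in
/-- A harmonic function is controlled by its averages over balls. -/
theorem exists_enorm_le_lintegral_closedBall [CompleteSpace F] :
    ∃ K : ℝ≥0, ∀ (f : E → F) (z : E) (r : ℝ), 0 < r →
    HarmonicOnNhd f (closedBall z r) →
    ‖f z‖ₑ ≤ K * (ENNReal.ofReal (r ^ Module.finrank ℝ E)⁻¹ * ∫⁻ w in closedBall z r, ‖f w‖ₑ) := by
  set c := ∫ w : E, radialWeight w
  have hc : 0 < c := integral_radialWeight_pos
  refine ⟨c⁻¹.toNNReal, fun f z r hr hf => ?_⟩
  obtain ⟨R, hR, hfR⟩ : ∃ R, r < R ∧ HarmonicOnNhd f (ball z R) := by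
    obtain ⟨δ, hδ, hsub⟩ := (isCompact_closedBall z r).exists_thickening_subset_open
      (isOpen_setOfPred_harmonicAt f) hf
    refine ⟨δ + r, by linarith, fun y hy => hsub ?_⟩
    rwa [thickening_closedBall hδ hr.le]
  have hmv := integral_radialWeight_smul_eq hfR (r := r) (by rwa [abs_of_pos hr])
  rw [← setLIntegral_comp_add_smul_closedBall (fun w => ‖f w‖ₑ) z hr]
  have h1 : ‖f z‖ₑ = ENNReal.ofReal c⁻¹ * ‖c • f z‖ₑ := by
    rw [enorm_smul, ← mul_assoc, Real.enorm_of_nonneg hc.le, ← ENNReal.ofReal_mul (by positivity),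
      inv_mul_cancel₀ hc.ne', ENNReal.ofReal_one, one_mul]
  rw [h1, ← hmv]
  change ENNReal.ofReal c⁻¹ * _ ≤ ENNReal.ofReal c⁻¹ * _
  gcongr
  refine (enorm_integral_le_lintegral_enorm _).trans ?_
  rw [← lintegral_indicator measurableSet_closedBall]
  refine lintegral_mono fun w => ?_
  by_cases hw : w ∈ closedBall (0 : E) 1
  · rw [Set.indicator_of_mem hw, enorm_smul, Real.enorm_of_nonneg (radialWeight_nonneg w)]
    exact mul_le_of_le_one_left zero_le
      (ENNReal.ofReal_le_one.2 (radialWeight_le_one w))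
  · simp [radialWeight_eq_zero hw]

end MeanValue

/-! ### Mean value inequality for all positive powers -/

section SubharmonicPowers

open InnerProductSpace Topology Metric Module

variable (E F : Type*) [NormedAddCommGroup E] [InnerProductSpace ℝ E] [FiniteDimensional ℝ E]
  [MeasurableSpace E] [BorelSpace E] [NormedAddCommGroup F] [NormedSpace ℝ F] [CompleteSpace F]

/-- Jensen's inequality on the unit ball, after rescaling, turns the `L¹` bound into an `L^s` bound.
-/
lemma exists_enorm_rpow_le_of_one_le {s : ℝ} (hs : 1 ≤ s) :
    ∃ K : ℝ≥0, ∀ (f : E → F) (z : E) (r : ℝ), 0 < r → HarmonicOnNhd f (closedBall z r) →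
      ENNReal.ofReal (r ^ finrank ℝ E) * ‖f z‖ₑ ^ s ≤
        K * ∫⁻ w in closedBall z r, ‖f w‖ₑ ^ s := by
  obtain ⟨K, hK⟩ := exists_enorm_le_lintegral_closedBall E F
  have hs0 : 0 < s := by linarith
  set V : ℝ≥0∞ := volume (closedBall (0 : E) 1)
  have hV : V ≠ ⊤ := measure_closedBall_lt_top.ne
  refine ⟨((K : ℝ≥0∞) ^ s * V ^ (s - 1)).toNNReal, fun f z r hr hf => ?_⟩
  rw [ENNReal.coe_toNNReal (ENNReal.mul_ne_top (by simp [hs0.le])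
    (ENNReal.rpow_ne_top_of_nonneg (by linarith) hV))]
  have h1 := hK f z r hr hf
  rw [← setLIntegral_comp_add_smul_closedBall (fun w => ‖f w‖ₑ) z hr] at h1
  have hc : ContinuousOn (fun w => f (z + r • w)) (closedBall 0 1) := by
    refine hf.continuousOn.comp (by fun_prop) fun w hw => ?_
    rw [mem_closedBall_zero_iff] at hw
    rw [mem_closedBall_iff_norm, add_sub_cancel_left, norm_smul, Real.norm_of_nonneg hr.le]
    exact mul_le_of_le_one_right hr.le hw
  have h2 := eLpNorm'_le_eLpNorm'_mul_rpow_measure_univ (μ := volume.restrict (closedBall 0 1))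
    one_pos hs (hc.aestronglyMeasurable measurableSet_closedBall)
  simp only [eLpNorm', ENNReal.rpow_one, div_one, Measure.restrict_apply MeasurableSet.univ,
    Set.univ_inter, div_one] at h2
  have h3 := setLIntegral_comp_add_smul_closedBall (fun w => ‖f w‖ₑ ^ s) z hr
  calc ENNReal.ofReal (r ^ finrank ℝ E) * ‖f z‖ₑ ^ s
      ≤ ENNReal.ofReal (r ^ finrank ℝ E) *
        (K * ((∫⁻ w in closedBall 0 1, ‖f (z + r • w)‖ₑ ^ s) ^ (1 / s) * V ^ (1 - 1 / s))) ^ s := by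
        gcongr
        exact h1.trans (by gcongr)
    _ = K ^ s * V ^ (s - 1) * (ENNReal.ofReal (r ^ finrank ℝ E) *
        ∫⁻ w in closedBall 0 1, ‖f (z + r • w)‖ₑ ^ s) := by
        rw [ENNReal.mul_rpow_of_nonneg _ _ hs0.le, ENNReal.mul_rpow_of_nonneg _ _ hs0.le,
          ← ENNReal.rpow_mul, ← ENNReal.rpow_mul, one_div_mul_cancel hs0.ne', ENNReal.rpow_one,
          show (1 - 1 / s) * s = s - 1 by field_simp]
        ring
    _ = K ^ s * V ^ (s - 1) * ∫⁻ w in closedBall z r, ‖f w‖ₑ ^ s := by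
        rw [h3, ← mul_assoc (ENNReal.ofReal _), ← ENNReal.ofReal_mul (by positivity),
          mul_inv_cancel₀ (by positivity), ENNReal.ofReal_one, one_mul]

/-- Let `w` maximise `|f(w)| (r - |w - z|)^{d/s}`, and put `a = |f(w)|`, `ρ = r - |w - z|`. On the
ball of radius `ρ/2` about `w`, `|f| ≤ 2^{d/s} a`, so the `L¹` bound at `w` and `|f| = |f|^{1-s}
|f|^s` give `a ≲ ρ^{-d} a^{1-s} ∫ |f|^s`. Dividing by `a^{1-s}` bounds `a^s ρ^d`, which dominates
`|f(z)|^s r^d` by maximality. -/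
lemma exists_enorm_rpow_le_of_le_one [Nontrivial E] {s : ℝ} (hs0 : 0 < s) (hs : s ≤ 1) :
    ∃ K : ℝ≥0, ∀ (f : E → F) (z : E) (r : ℝ), 0 < r → HarmonicOnNhd f (closedBall z r) →
      ENNReal.ofReal (r ^ finrank ℝ E) * ‖f z‖ₑ ^ s ≤
        K * ∫⁻ w in closedBall z r, ‖f w‖ₑ ^ s := by
  obtain ⟨K, hK⟩ := exists_enorm_le_lintegral_closedBall E F
  set d := finrank ℝ E
  set B : ℝ := 2 ^ (d / s)
  have hB : 0 < B := by positivity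
  refine ⟨(K * 2 ^ d * B ^ (1 - s)).toNNReal, fun f z r hr hf => ?_⟩
  by_cases hI : ∫⁻ w in closedBall z r, ‖f w‖ₑ ^ s = ⊤
  · rw [hI]
    -- A vanishing constant needs its own case because `0 * ∞ = 0`; then `K = 0` forces `f z = 0`.
    by_cases hK0 : (K * 2 ^ d * B ^ (1 - s)).toNNReal = 0
    · have hK0' : K = 0 := by
        rw [Real.toNNReal_eq_zero] at hK0
        by_contra h
        have : 0 < (K : ℝ) := by exact_mod_cast pos_iff_ne_zero.2 h
        have : 0 < K * 2 ^ d * B ^ (1 - s) := by positivity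
        linarith
      have := hK f z r hr hf
      rw [hK0', ENNReal.coe_zero, zero_mul] at this
      simp [le_zero_iff.1 this, hs0]
    · rw [ENNReal.mul_top (by simpa using hK0)]
      exact le_top
  obtain ⟨w, hw, hmax⟩ := (isCompact_closedBall z r).exists_isMaxOn ⟨z, mem_closedBall_self hr.le⟩
    (f := fun w => ‖f w‖ * (r - dist w z) ^ (d / s))
    (hf.continuousOn.norm.mul (ContinuousOn.rpow_const (by fun_prop)
      fun _ _ => Or.inr (by positivity)))
  have hz := hmax (mem_closedBall_self hr.le)
  simp only [Set.mem_ofPred_eq, dist_self, sub_zero] at hz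
  set a := ‖f w‖
  set ρ := r - dist w z
  rcases (norm_nonneg (f z)).eq_or_lt with h0 | h0
  · rw [eq_comm, norm_eq_zero] at h0
    simp [h0, hs0]
  have hprod : 0 < a * ρ ^ (d / s) := lt_of_lt_of_le (by positivity) hz
  have ha : 0 < a := by
    rcases (norm_nonneg (f w)).eq_or_lt with h | h
    · exfalso
      have : a = 0 := h.symm
      rw [this, zero_mul] at hprod
      exact lt_irrefl _ hprod
    · exact h
  have hρ0 : 0 ≤ ρ := sub_nonneg.2 hw
  have hpow : ∀ x : ℝ, 0 ≤ x → (x ^ (d / s)) ^ s = x ^ d := fun x hx => by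
    rw [← Real.rpow_mul hx, div_mul_cancel₀ _ hs0.ne', Real.rpow_natCast]
  have hle : ‖f z‖ ^ s * r ^ d ≤ a ^ s * ρ ^ d := by
    rw [← hpow r hr.le, ← hpow ρ hρ0, ← Real.mul_rpow (by positivity) (by positivity),
      ← Real.mul_rpow ha.le (by positivity)]
    exact Real.rpow_le_rpow (by positivity) hz hs0.le
  -- The maximum is not on the sphere, where the weight vanishes because `d / s > 0`. This is where
  -- the dimension must be positive.
  have hρ : 0 < ρ := by
    refine hρ0.lt_of_ne' fun h => ?_
    rw [h, Real.zero_rpow (div_pos (by exact_mod_cast finrank_pos) hs0).ne', mul_zero] at hprod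
    exact lt_irrefl _ hprod
  have hsub : closedBall w (ρ / 2) ⊆ closedBall z r :=
    closedBall_subset_closedBall' (by simp only [ρ]; linarith [dist_nonneg (x := w) (y := z)])
  have hnear : ∀ y ∈ closedBall w (ρ / 2), ‖f y‖ ≤ a * B := by
    intro y hy
    have h1 := hmax (hsub hy)
    simp only [Set.mem_ofPred_eq] at h1
    have h2 : ρ / 2 ≤ r - dist y z := by
      have := dist_triangle y w z
      rw [mem_closedBall] at hy
      simp only [ρ] at hy ⊢
      linarith
    have h3 : ‖f y‖ * (ρ / 2) ^ (d / s) ≤ a * ρ ^ (d / s) :=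
      le_trans (by gcongr) h1
    have h4 : ρ ^ (d / s) = B * (ρ / 2) ^ (d / s) := by
      rw [← Real.mul_rpow (by norm_num) (by positivity), mul_div_cancel₀ _ (by norm_num)]
    rw [h4, ← mul_assoc] at h3
    exact le_of_mul_le_mul_right h3 (by positivity)
  have hint : ∫⁻ y in closedBall w (ρ / 2), ‖f y‖ₑ ≤
      ENNReal.ofReal ((a * B) ^ (1 - s)) * ∫⁻ y in closedBall z r, ‖f y‖ₑ ^ s := by
    rw [← lintegral_const_mul' _ _ ENNReal.ofReal_ne_top]
    refine le_trans (setLIntegral_mono' measurableSet_closedBall fun y hy => ?_)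
      (lintegral_mono_set hsub)
    rw [← ofReal_norm, ENNReal.ofReal_rpow_of_nonneg (norm_nonneg _) hs0.le,
      ← ENNReal.ofReal_mul (by positivity)]
    refine ENNReal.ofReal_le_ofReal ?_
    rcases (norm_nonneg (f y)).eq_or_lt with h | h
    · rw [← h]; positivity
    · calc ‖f y‖ = ‖f y‖ ^ (1 - s) * ‖f y‖ ^ s := by
            rw [← Real.rpow_add h, sub_add_cancel, Real.rpow_one]
        _ ≤ _ := by
            gcongr
            exact hnear y hy
  set J := (∫⁻ y in closedBall z r, ‖f y‖ₑ ^ s).toReal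
  have hJ : ∫⁻ y in closedBall z r, ‖f y‖ₑ ^ s = ENNReal.ofReal J :=
    (ENNReal.ofReal_toReal hI).symm
  have hJ0 : 0 ≤ J := ENNReal.toReal_nonneg
  have hmain : a ≤ K * (((ρ / 2) ^ d)⁻¹ * ((a * B) ^ (1 - s) * J)) := by
    have h1 := hK f w (ρ / 2) (by positivity) fun y hy => hf y (hsub hy)
    have h2 := h1.trans (mul_le_mul_right (mul_le_mul_right hint _) _)
    rw [hJ, ← ENNReal.ofReal_mul (by positivity), ← ENNReal.ofReal_mul (by positivity),
      ← ENNReal.ofReal_coe_nnreal, ← ENNReal.ofReal_mul (by positivity), ← ofReal_norm] at h2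
    exact (ENNReal.ofReal_le_ofReal_iff (by positivity)).1 h2
  have hfin : a ^ s * ρ ^ d ≤ K * 2 ^ d * B ^ (1 - s) * J := by
    have h1 : a ^ s * a ^ (1 - s) = a := by
      rw [← Real.rpow_add ha, add_sub_cancel, Real.rpow_one]
    have h2 : 0 < a ^ (1 - s) := by positivity
    refine le_of_mul_le_mul_right ?_ h2
    calc a ^ s * ρ ^ d * a ^ (1 - s) = a * ρ ^ d := by rw [mul_right_comm, h1]
      _ ≤ K * (((ρ / 2) ^ d)⁻¹ * ((a * B) ^ (1 - s) * J)) * ρ ^ d := by gcongr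
      _ = _ := by
        rw [Real.mul_rpow ha.le hB.le, div_pow]
        field_simp
  rw [hJ, ← ENNReal.ofReal_coe_nnreal, Real.coe_toNNReal _ (by positivity), ← ofReal_norm,
    ENNReal.ofReal_rpow_of_nonneg (norm_nonneg _) hs0.le, ← ENNReal.ofReal_mul (by positivity),
    ← ENNReal.ofReal_mul (by positivity)]
  refine ENNReal.ofReal_le_ofReal ?_
  rw [mul_comm]
  exact hle.trans hfin

/-- Positive powers of the modulus of a harmonic function are controlled by their averages over
balls. -/
theorem exists_enorm_rpow_le [Nontrivial E] {s : ℝ} (hs : 0 < s) :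
    ∃ K : ℝ≥0, ∀ (f : E → F) (z : E) (r : ℝ), 0 < r → HarmonicOnNhd f (closedBall z r) →
      ENNReal.ofReal (r ^ finrank ℝ E) * ‖f z‖ₑ ^ s ≤
        K * ∫⁻ w in closedBall z r, ‖f w‖ₑ ^ s :=
  (le_total s 1).elim (exists_enorm_rpow_le_of_le_one E F hs) (exists_enorm_rpow_le_of_one_le E F)

end SubharmonicPowers

/-! ### Volume, diameter and distance to the boundary of cubes -/

section Cubes

variable {n : ℕ}

lemma EuclideanSpace.norm_le_of_abs_le {ι : Type*} [Fintype ι] {z : EuclideanSpace ℝ ι} {c : ℝ}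
    (hc : 0 ≤ c) (h : ∀ i, |z i| ≤ c) : ‖z‖ ≤ Fintype.card ι * c := by
  refine abs_le_of_sq_le_sq' ?_ (by positivity) |>.2
  rw [EuclideanSpace.real_norm_sq_eq]
  calc ∑ i, z i ^ 2 ≤ ∑ _i : ι, c ^ 2 :=
        Finset.sum_le_sum fun i _ => sq_le_sq' (neg_le_of_abs_le (h i)) (le_of_abs_le (h i))
    _ = Fintype.card ι * c ^ 2 := by simp
    _ ≤ (Fintype.card ι * c) ^ 2 := by
        rw [mul_pow]
        gcongr
        exact_mod_cast Nat.le_self_pow two_ne_zero _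

lemma isOpen_upperHalfSpace : IsOpen (upperHalfSpace n) :=
  isOpen_lt continuous_const (by fun_prop)

lemma frontier_upperHalfSpace : frontier (upperHalfSpace n) = {z | z (Fin.last n) = 0} := by
  let coord : EuclideanSpace ℝ (Fin (n + 1)) →L[ℝ] ℝ := EuclideanSpace.proj (Fin.last n)
  have ho : IsOpenMap coord :=
    ContinuousLinearMap.isOpenMap _ fun t => ⟨EuclideanSpace.single (Fin.last n) t, by simp [coord]⟩
  have h : upperHalfSpace n =
      coord ⁻¹' Set.Ioi 0 := by
    ext z; simp [upperHalfSpace, coord]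
  rw [h, ← ho.preimage_frontier_eq_frontier_preimage (by fun_prop), frontier_Ioi]
  ext z; simp [coord]

variable {ζ : EuclideanSpace ℝ (Fin (n + 1))} {l : ℝ}

lemma isClosed_closedCube : IsClosed (closedCube ζ l) := by
  simp only [closedCube, Set.ofPred_forall]
  exact isClosed_iInter fun i => isClosed_le (by fun_prop) continuous_const

lemma volume_closedCube (hl : 0 ≤ l) :
    volume (closedCube ζ l) = ENNReal.ofReal (l ^ (n + 1)) := by
  have h : closedCube ζ l = (MeasurableEquiv.toLp 2 (Fin (n + 1) → ℝ)).symm ⁻¹'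
      Metric.closedBall (ζ.ofLp) (l / 2) := by
    ext z
    simp [closedCube, dist_pi_le_iff (show 0 ≤ l / 2 by linarith), Real.dist_eq]
  rw [h, (EuclideanSpace.volume_preserving_symm_measurableEquiv_toLp
    (Fin (n + 1))).measure_preimage measurableSet_closedBall.nullMeasurableSet,
    Real.volume_pi_closedBall _ (by linarith)]
  rw [mul_div_cancel₀ _ two_ne_zero, Fintype.card_fin]

lemma le_volume_interior_closedCube (hl : 0 < l) :
    ENNReal.ofReal (l ^ (n + 1)) ≤ volume (interior (closedCube ζ l)) := by
  have h : {z : EuclideanSpace ℝ (Fin (n + 1)) | ∀ i, |z i - ζ i| < l / 2} =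
       (MeasurableEquiv.toLp 2 (Fin (n + 1) → ℝ)).symm ⁻¹'
      Metric.ball (ζ.ofLp) (l / 2) := by
    ext z
    simp [dist_pi_lt_iff (half_pos hl), Real.dist_eq]
  have hv : volume {z : EuclideanSpace ℝ (Fin (n + 1)) | ∀ i, |z i - ζ i| < l / 2} = ENNReal.ofReal (l ^ (n + 1)) := by
    rw [h, (EuclideanSpace.volume_preserving_symm_measurableEquiv_toLp
      (Fin (n + 1))).measure_preimage measurableSet_ball.nullMeasurableSet,
      Real.volume_pi_ball _ (half_pos hl)]
    rw [mul_div_cancel₀ _ two_ne_zero, Fintype.card_fin]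
  rw [← hv]
  refine measure_mono (interior_maximal (fun z hz i => (hz i).le) ?_)
  simp only [Set.ofPred_forall]
  exact isOpen_iInter_of_finite fun i => isOpen_lt (by fun_prop) continuous_const

lemma ediam_closedCube_le (hl : 0 ≤ l) :
    Metric.ediam (closedCube ζ l) ≤ ENNReal.ofReal ((n + 1) * l) := by
  refine Metric.ediam_le fun x hx y hy => ?_
  rw [edist_dist, dist_eq_norm]
  refine ENNReal.ofReal_le_ofReal ?_
  refine (EuclideanSpace.norm_le_of_abs_le hl fun i => ?_).trans_eq (by simp)
  have h1 := abs_le.1 (hx i)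
  have h2 := abs_le.1 (hy i)
  simp only [PiLp.sub_apply]
  exact abs_le.2 ⟨by linarith, by linarith⟩

lemma add_single_mem_closedCube {t : ℝ} (hl : 0 ≤ l) (ht : |t| ≤ l / 2) (j : Fin (n + 1)) :
    ζ + EuclideanSpace.single j t ∈ closedCube ζ l := by
  intro i
  simp only [PiLp.add_apply, add_sub_cancel_left, PiLp.single_apply]
  split_ifs
  · exact ht
  · rw [abs_zero]
    linarith

lemma le_ediam_closedCube (hl : 0 ≤ l) :
    ENNReal.ofReal l ≤ Metric.ediam (closedCube ζ l) := by
  have h := Metric.edist_le_ediam_of_mem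
    (add_single_mem_closedCube (ζ := ζ) (t := l / 2) hl (by rw [abs_of_nonneg (by linarith)]) 0)
    (add_single_mem_closedCube (ζ := ζ) (t := -(l / 2)) hl
      (by rw [abs_neg, abs_of_nonneg (by linarith)]) 0)
  refine le_trans (le_of_eq ?_) h
  rw [edist_dist, dist_add_left, PiLp.dist_single_same, Real.dist_eq]
  congr 1
  rw [abs_of_nonneg (by linarith)]
  ring

lemma setEDist_closedCube_frontier (hl : 0 ≤ l) (h : l / 2 ≤ ζ (Fin.last n)) :
    setEDist (closedCube ζ l) (frontier (upperHalfSpace n)) =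
      ENNReal.ofReal (ζ (Fin.last n) - l / 2) := by
  rw [frontier_upperHalfSpace]
  refine le_antisymm ?_ ?_
  · have h1 : ζ + EuclideanSpace.single (Fin.last n) (-(l / 2)) ∈ closedCube ζ l :=
      add_single_mem_closedCube hl (by rw [abs_neg, abs_of_nonneg (by linarith)]) _
    have h2 : ζ + EuclideanSpace.single (Fin.last n) (-(ζ (Fin.last n))) ∈
        {z : EuclideanSpace ℝ (Fin (n + 1)) | z (Fin.last n) = 0} := by simp
    refine (iInf₂_le_of_le _ h1 (iInf₂_le _ h2)).trans_eq ?_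
    rw [edist_dist, dist_add_left, PiLp.dist_single_same, Real.dist_eq]
    congr 1
    rw [abs_of_nonneg (by linarith)]
    ring
  · refine le_iInf₂ fun x hx => le_iInf₂ fun y hy => ?_
    have hy : y (Fin.last n) = 0 := hy
    rw [edist_dist, dist_eq_norm]
    refine ENNReal.ofReal_le_ofReal ?_
    have h1 := PiLp.norm_apply_le (x - y) (Fin.last n)
    have h2 := abs_le.1 (hx (Fin.last n))
    rw [PiLp.sub_apply, hy, sub_zero, Real.norm_eq_abs] at h1
    linarith [le_abs_self (x (Fin.last n))]

end Cubes

/-! ### Geometry of Whitney cubes and bounded overlap -/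

section Whitney

variable {n : ℕ} {ζ : ℕ → EuclideanSpace ℝ (Fin (n + 1))} {l : ℕ → ℝ}

lemma IsWhitneyDecomposition.closedCube_subset (hW : IsWhitneyDecomposition ζ l) (k : ℕ) :
    closedCube (ζ k) (l k) ⊆ upperHalfSpace n :=
  hW.iUnion_eq ▸ Set.subset_iUnion (fun k => closedCube (ζ k) (l k)) k

lemma IsWhitneyDecomposition.half_side_lt (hW : IsWhitneyDecomposition ζ l) (k : ℕ) :
    l k / 2 < ζ k (Fin.last n) := by
  have hl := hW.side_pos k
  have h := hW.closedCube_subset k (add_single_mem_closedCube (t := -(l k / 2)) hl.le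
    (by rw [abs_neg, abs_of_nonneg (by linarith)]) (Fin.last n))
  simp [upperHalfSpace] at h
  exact h

lemma IsWhitneyDecomposition.center_pos (hW : IsWhitneyDecomposition ζ l) (k : ℕ) :
    0 < ζ k (Fin.last n) :=
  (half_pos (hW.side_pos k)).trans (hW.half_side_lt k)

/-- The height of the bottom of a Whitney cube and its side length are comparable to the height of
its centre. -/
lemma IsWhitneyDecomposition.exists_comparable (hW : IsWhitneyDecomposition ζ l) :
    ∃ δ : ℝ, 0 < δ ∧ ∀ k, δ * ζ k (Fin.last n) ≤ ζ k (Fin.last n) - l k / 2 ∧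
      δ * ζ k (Fin.last n) ≤ l k := by
  obtain ⟨c, C, hc, h⟩ := hW.diam_comparable
  have hc' : (0 : ℝ) < c := hc
  have h1 : ∀ k, c * (ζ k (Fin.last n) - l k / 2) ≤ (n + 1) * l k := fun k => by
    have hl := (hW.side_pos k).le
    have h0 := hW.half_side_lt k
    have := (h k).1.trans (ediam_closedCube_le hl)
    rw [setEDist_closedCube_frontier hl h0.le, ← ENNReal.ofReal_coe_nnreal,
      ← ENNReal.ofReal_mul c.coe_nonneg] at this
    exact (ENNReal.ofReal_le_ofReal_iff (by positivity)).1 this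
  have h2 : ∀ k, l k ≤ C * (ζ k (Fin.last n) - l k / 2) := fun k => by
    have hl := (hW.side_pos k).le
    have h0 := hW.half_side_lt k
    have := (le_ediam_closedCube hl).trans (h k).2
    rw [setEDist_closedCube_frontier hl h0.le, ← ENNReal.ofReal_coe_nnreal,
      ← ENNReal.ofReal_mul C.coe_nonneg] at this
    exact (ENNReal.ofReal_le_ofReal_iff (mul_nonneg C.coe_nonneg (by linarith))).1 this
  have hC := C.coe_nonneg
  -- Write `η` as the bottom height plus `l / 2`. The first entry comes from bounding `l` by the
  -- bottom height, the second from bounding the bottom height by `l`.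
  refine ⟨min (1 + C / 2)⁻¹ ((n + 1) / c + 1 / 2 : ℝ)⁻¹,
    lt_min (by positivity) (by positivity), fun k => ⟨?_, ?_⟩⟩
  · have := hW.center_pos k
    calc _ ≤ (1 + C / 2 : ℝ)⁻¹ * ζ k (Fin.last n) := by gcongr; exact min_le_left _ _
      _ ≤ _ := by
        rw [inv_mul_le_iff₀ (by positivity)]
        linarith [h2 k]
  · have := hW.center_pos k
    calc _ ≤ ((n + 1) / c + 1 / 2 : ℝ)⁻¹ * ζ k (Fin.last n) := by gcongr; exact min_le_right _ _
      _ ≤ _ := by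
        rw [inv_mul_le_iff₀ (by positivity)]
        have := h1 k
        rw [mul_comm, ← le_div_iff₀ hc'] at this
        calc ζ k (Fin.last n) ≤ (n + 1) * l k / c + l k / 2 := by linarith
          _ = _ := by ring

/-- A neighbourhood of the cubes centred at `c` on which the height is comparable to that of
`c`. -/
def cubeNhd (δ : ℝ) (c : EuclideanSpace ℝ (Fin (n + 1))) : Set (EuclideanSpace ℝ (Fin (n + 1))) :=
  {w | (∀ i, |w i - c i| ≤ 2 * c (Fin.last n)) ∧ δ / 2 * c (Fin.last n) ≤ w (Fin.last n)}

lemma isClosed_cubeNhd (δ : ℝ) (c : EuclideanSpace ℝ (Fin (n + 1))) : IsClosed (cubeNhd δ c) := by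
  refine IsClosed.and ?_ (isClosed_le continuous_const (by fun_prop))
  simp only [Set.ofPred_forall]
  exact isClosed_iInter fun i => isClosed_le (by fun_prop) continuous_const

/-- Volume counting. If `w` has height `τ` and lies in the neighbourhood of the `k`-th cube, then
`τ/3 ≤ η_k ≤ 2τ/δ`. Such cubes have side at least `δτ/3` and interiors inside the cube of side
`12τ/δ` about `w`. Since the interiors are disjoint, their number is at most the ratio
`(36/δ²)^{n+1}` of the volumes. -/
lemma IsWhitneyDecomposition.exists_tsum_indicator_le (hW : IsWhitneyDecomposition ζ l)
    {δ : ℝ} (hδ : 0 < δ) (hl : ∀ k, δ * ζ k (Fin.last n) ≤ l k) :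
    ∃ N : ℝ≥0, ∀ w, ∑' k, (cubeNhd δ (ζ k)).indicator (fun _ => (1 : ℝ≥0∞)) w ≤ N := by
  refine ⟨((36 / δ ^ 2) ^ (n + 1)).toNNReal, fun w => ?_⟩
  set τ := w (Fin.last n)
  rcases le_or_gt τ 0 with hτ | hτ
  · refine le_trans (le_of_eq ?_) zero_le
    refine ENNReal.tsum_eq_zero.2 fun k => Set.indicator_of_notMem (fun hw => ?_) _
    have := hW.center_pos k
    have : 0 < δ / 2 * ζ k (Fin.last n) := by positivity
    exact absurd (this.trans_le hw.2) (not_lt.2 hτ)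
  set Q := closedCube w (12 * τ / δ)
  have hterm : ∀ k, (cubeNhd δ (ζ k)).indicator (fun _ => (1 : ℝ≥0∞)) w *
      ENNReal.ofReal ((δ * τ / 3) ^ (n + 1)) ≤ volume (interior (closedCube (ζ k) (l k)) ∩ Q) := by
    intro k
    by_cases hw : w ∈ cubeNhd δ (ζ k)
    · have hη := hW.center_pos k
      have hh := hW.half_side_lt k
      have hsub : interior (closedCube (ζ k) (l k)) ⊆ Q := by
        intro y hy i
        have h1 := abs_le.1 (interior_subset hy i)
        have h2 := abs_le.1 (hw.1 i)
        have h3 : ζ k (Fin.last n) ≤ 2 * τ / δ := by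
          rw [le_div_iff₀ hδ]
          linarith [hw.2]
        have h4 : 12 * τ / δ / 2 = 3 * (2 * τ / δ) := by ring
        rw [h4]
        exact abs_le.2 ⟨by linarith, by linarith⟩
      rw [Set.indicator_of_mem hw, Set.inter_eq_left.2 hsub, one_mul]
      refine le_trans (ENNReal.ofReal_le_ofReal ?_)
        (le_volume_interior_closedCube (hW.side_pos k))
      have h5 := (abs_le.1 (hw.1 (Fin.last n))).2
      have h6 : τ / 3 ≤ ζ k (Fin.last n) := by simp only [τ]; linarith
      have h7 : δ * τ / 3 ≤ l k := by
        refine le_trans ?_ (hl k)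
        rw [mul_div_assoc]
        gcongr
      gcongr
    · rw [Set.indicator_of_notMem hw, zero_mul]
      exact zero_le
  have hsum : (∑' k, (cubeNhd δ (ζ k)).indicator (fun _ => (1 : ℝ≥0∞)) w) *
      ENNReal.ofReal ((δ * τ / 3) ^ (n + 1)) ≤ ENNReal.ofReal ((12 * τ / δ) ^ (n + 1)) := by
    rw [← ENNReal.tsum_mul_right, ← volume_closedCube (ζ := w) (l := 12 * τ / δ) (by positivity)]
    refine (ENNReal.tsum_le_tsum hterm).trans ?_
    rw [← measure_iUnion]
    · exact measure_mono (Set.iUnion_subset fun k => Set.inter_subset_right)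
    · exact fun j k hjk => (hW.disjoint_interior j k hjk).mono Set.inter_subset_left
        Set.inter_subset_left
    · exact fun k => isOpen_interior.measurableSet.inter isClosed_closedCube.measurableSet
  have hp : 0 < (δ * τ / 3) ^ (n + 1) := by positivity
  rw [← ENNReal.le_div_iff_mul_le (Or.inl (by simpa using hp)) (Or.inl ENNReal.ofReal_ne_top),
    ← ENNReal.ofReal_div_of_pos hp] at hsum
  refine hsum.trans_eq ?_
  change _ = ENNReal.ofReal _
  rw [← div_pow]
  congr 2
  field_simp
  norm_num

end Whitney

/-! ### From the measure condition to the norm inequality -/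

section Sufficiency

open InnerProductSpace

variable {n : ℕ} {𝕜 : Type*} [RCLike 𝕜]

lemma min_rpow_le_rpow {a b x β : ℝ} (ha : 0 < a) (hax : a ≤ x) (hxb : x ≤ b) :
    min (a ^ β) (b ^ β) ≤ x ^ β := by
  rcases le_total 0 β with h | h
  · exact (min_le_left _ _).trans (Real.rpow_le_rpow ha.le hax h)
  · exact (min_le_right _ _).trans (Real.rpow_le_rpow_of_nonpos (ha.trans_le hax) hxb h)

lemma cubeNhd_subset_upperHalfSpace {δ : ℝ} (hδ : 0 < δ) {c : EuclideanSpace ℝ (Fin (n + 1))}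
    (hc : 0 < c (Fin.last n)) : cubeNhd δ c ⊆ upperHalfSpace n := fun _ hw =>
  (by positivity : 0 < δ / 2 * c (Fin.last n)).trans_le hw.2

lemma bergmanNorm_rpow {s β : ℝ} (hs : 0 < s) (f : EuclideanSpace ℝ (Fin (n + 1)) → 𝕜) :
    bergmanNorm s β f ^ s =
      ∫⁻ z in upperHalfSpace n, ‖f z‖ₑ ^ s * ENNReal.ofReal (z (Fin.last n) ^ β) := by
  rw [bergmanNorm, ← ENNReal.rpow_mul, one_div_mul_cancel hs.ne', ENNReal.rpow_one]

variable (n 𝕜) in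
/-- The pointwise bound of a harmonic function by a local piece of its Bergman norm. -/
lemma exists_enorm_rpow_le_setLIntegral_cubeNhd {s δ : ℝ} (hs : 0 < s) (hδ : 0 < δ) (β : ℝ) :
    ∃ K : ℝ≥0, ∀ (f : EuclideanSpace ℝ (Fin (n + 1)) → 𝕜) (c z : EuclideanSpace ℝ (Fin (n + 1))),
      HarmonicOnNhd f (upperHalfSpace n) → 0 < c (Fin.last n) →
      (∀ i, |z i - c i| ≤ c (Fin.last n)) → δ * c (Fin.last n) ≤ z (Fin.last n) →
      ‖f z‖ₑ ^ s ≤ K * ENNReal.ofReal (c (Fin.last n) ^ (-(n + 1 + β))) *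
        ∫⁻ w in cubeNhd δ c, ‖f w‖ₑ ^ s * ENNReal.ofReal (w (Fin.last n) ^ β) := by
  obtain ⟨K, hK⟩ := exists_enorm_rpow_le (EuclideanSpace ℝ (Fin (n + 1))) 𝕜 hs
  -- On the ball used below, heights lie between `δη/2` and `3η`. The minimum handles both signs of
  -- `β`, so that `t^β ≥ m η^β` there.
  set m : ℝ := min ((δ / 2) ^ β) (3 ^ β)
  have hm : 0 < m := lt_min (by positivity) (by positivity)
  refine ⟨K * (((δ / 2) ^ (n + 1))⁻¹ * m⁻¹).toNNReal, fun f c z hf hc hz hzn => ?_⟩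
  set η := c (Fin.last n)
  -- This radius leaves height at least `δη/2`. It is at most `η` because `δη ≤ z_{n+1} ≤ 2η`, so
  -- the ball about `z` stays in the neighbourhood.
  set r := δ / 2 * η
  have hr : 0 < r := by positivity
  have hrη : r ≤ η := by
    have := (abs_le.1 (hz (Fin.last n))).2
    simp only [r]
    linarith
  have hball : ∀ w ∈ Metric.closedBall z r, ∀ i, |w i - z i| ≤ r := fun w hw i => by
    have h1 := PiLp.norm_apply_le (w - z) i
    rw [PiLp.sub_apply, Real.norm_eq_abs] at h1
    exact h1.trans (mem_closedBall_iff_norm.1 hw)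
  have hlow : ∀ w ∈ Metric.closedBall z r, r ≤ w (Fin.last n) := fun w hw => by
    have := (abs_le.1 (hball w hw (Fin.last n))).1
    have h2 : δ * η = 2 * r := by simp only [r]; ring
    linarith
  have hup : ∀ w ∈ Metric.closedBall z r, ∀ i, |w i - c i| ≤ 2 * η := fun w hw i => by
    have h1 := abs_sub_le (w i) (z i) (c i)
    linarith [hball w hw i, hz i]
  have hsub : Metric.closedBall z r ⊆ cubeNhd δ c := fun w hw => ⟨hup w hw, hlow w hw⟩
  have h1 := hK f z r hr fun w hw => hf w (cubeNhd_subset_upperHalfSpace hδ hc (hsub hw))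
  rw [finrank_euclideanSpace_fin] at h1
  have hweight : ∀ w ∈ Metric.closedBall z r, ‖f w‖ₑ ^ s ≤
      ENNReal.ofReal ((m * η ^ β)⁻¹) * (‖f w‖ₑ ^ s * ENNReal.ofReal (w (Fin.last n) ^ β)) := by
    intro w hw
    rw [mul_left_comm, ← ENNReal.ofReal_mul (by positivity)]
    refine le_mul_of_one_le_right zero_le ?_
    rw [ENNReal.one_le_ofReal, ← div_eq_inv_mul, one_le_div (by positivity)]
    have h3 : w (Fin.last n) ≤ 3 * η := by
      have := (abs_le.1 (hup w hw (Fin.last n))).2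
      simp only [η] at this ⊢
      linarith
    refine le_trans (le_of_eq ?_) (min_rpow_le_rpow hr (hlow w hw) h3)
    rw [Real.mul_rpow (by positivity) hc.le, Real.mul_rpow (by norm_num) hc.le,
      ← min_mul_of_nonneg _ _ (by positivity)]
  have h2 : ∫⁻ w in Metric.closedBall z r, ‖f w‖ₑ ^ s ≤ ENNReal.ofReal ((m * η ^ β)⁻¹) *
      ∫⁻ w in cubeNhd δ c, ‖f w‖ₑ ^ s * ENNReal.ofReal (w (Fin.last n) ^ β) := by
    rw [← lintegral_const_mul' _ _ ENNReal.ofReal_ne_top]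
    exact (setLIntegral_mono' measurableSet_closedBall hweight).trans (lintegral_mono_set hsub)
  have hconst : (((δ / 2) ^ (n + 1))⁻¹ * m⁻¹) * η ^ (-(n + 1 + β)) =
      (r ^ (n + 1))⁻¹ * (m * η ^ β)⁻¹ := by
    have : η ^ (-(n + 1 + β)) = (η ^ (n + 1))⁻¹ * (η ^ β)⁻¹ := by
      rw [Real.rpow_neg hc.le, Real.rpow_add hc, ← mul_inv]
      norm_cast
    rw [this]
    simp only [r]
    rw [mul_pow, mul_inv, mul_inv]
    ring
  calc ‖f z‖ₑ ^ s = ENNReal.ofReal (r ^ (n + 1))⁻¹ *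
        (ENNReal.ofReal (r ^ (n + 1)) * ‖f z‖ₑ ^ s) := by
        rw [← mul_assoc, ← ENNReal.ofReal_mul (by positivity), inv_mul_cancel₀ (by positivity),
          ENNReal.ofReal_one, one_mul]
    _ ≤ ENNReal.ofReal (r ^ (n + 1))⁻¹ * (K * (ENNReal.ofReal ((m * η ^ β)⁻¹) *
      ∫⁻ w in cubeNhd δ c, ‖f w‖ₑ ^ s * ENNReal.ofReal (w (Fin.last n) ^ β))) := by
        exact mul_le_mul_right (h1.trans (mul_le_mul_right h2 _)) _
    _ = K * (ENNReal.ofReal (r ^ (n + 1))⁻¹ * ENNReal.ofReal ((m * η ^ β)⁻¹)) *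
      ∫⁻ w in cubeNhd δ c, ‖f w‖ₑ ^ s * ENNReal.ofReal (w (Fin.last n) ^ β) := by ring
    _ = _ := by
        rw [← ENNReal.ofReal_mul (by positivity), ← hconst, ENNReal.ofReal_mul (by positivity),
          ENNReal.coe_mul, ENNReal.ofReal]
        ring

/-- Passing to the measure with density `g` leaves only indicators to be summed under the integral,
so `g` need not be measurable. -/
lemma tsum_setLIntegral_le_mul {α : Type*} [MeasurableSpace α] {μ : Measure α} (g : α → ℝ≥0∞)
    {S : Set α} {A : ℕ → Set α} (hA : ∀ k, MeasurableSet (A k))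
    (hAS : ∀ k, A k ⊆ S) {N : ℝ≥0∞}
    (hN : ∀ w, ∑' k, (A k).indicator (fun _ => (1 : ℝ≥0∞)) w ≤ N) :
    ∑' k, ∫⁻ w in A k, g w ∂μ ≤ N * ∫⁻ w in S, g w ∂μ := by
  have h : ∀ k, ∫⁻ w in A k, g w ∂μ = ((μ.restrict S).withDensity g) (A k) := fun k => by
    rw [withDensity_apply _ (hA k), Measure.restrict_restrict (hA k),
      Set.inter_eq_left.2 (hAS k)]
  calc ∑' k, ∫⁻ w in A k, g w ∂μ
      = ∑' k, ∫⁻ w, (A k).indicator (fun _ => (1 : ℝ≥0∞)) w ∂(μ.restrict S).withDensity g := by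
        refine tsum_congr fun k => ?_
        rw [h, lintegral_indicator (hA k), setLIntegral_const, one_mul]
    _ = ∫⁻ w, ∑' k, (A k).indicator (fun _ => (1 : ℝ≥0∞)) w ∂(μ.restrict S).withDensity g :=
        (lintegral_tsum fun k => (measurable_const.indicator (hA k)).aemeasurable).symm
    _ ≤ ∫⁻ _, N ∂(μ.restrict S).withDensity g := lintegral_mono hN
    _ = N * ∫⁻ w in S, g w ∂μ := by
        rw [lintegral_const, withDensity_apply _ MeasurableSet.univ, Measure.restrict_univ]

/-- Write `a^r = a * a^(r-1)` and bound the second factor by the total sum. -/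
lemma ENNReal.tsum_rpow_le_rpow_tsum {ι : Type*} (a : ι → ℝ≥0∞) {r : ℝ} (hr : 1 ≤ r) :
    ∑' k, a k ^ r ≤ (∑' k, a k) ^ r := by
  have hsplit : ∀ x : ℝ≥0∞, x ^ r = x * x ^ (r - 1) := fun x => by
    conv_lhs => rw [show r = 1 + (r - 1) by ring]
    rw [ENNReal.rpow_add_of_nonneg _ _ zero_le_one (by linarith), ENNReal.rpow_one]
  calc ∑' k, a k ^ r ≤ ∑' k, a k * (∑' j, a j) ^ (r - 1) := by
        refine ENNReal.tsum_le_tsum fun k => ?_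
        rw [hsplit]
        gcongr
        exact ENNReal.le_tsum k
    _ = _ := by rw [ENNReal.tsum_mul_right, ← hsplit]

/-- All factors but the first are bounded by their full sums, and the first is summed. For `m = 0`
the left side would count the index set, hence `1 ≤ m`. -/
lemma ENNReal.tsum_prod_rpow_le {ι : Type*} {m : ℕ} (hm : 1 ≤ m) (a : Fin m → ι → ℝ≥0∞) {r : ℝ}
    (hr : 1 ≤ r) : ∑' k, ∏ i, a i k ^ r ≤ ∏ i, (∑' k, a i k) ^ r := by
  obtain ⟨m, rfl⟩ := Nat.exists_eq_add_of_le' hm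
  simp_rw [Fin.prod_univ_succ]
  calc ∑' k, a 0 k ^ r * ∏ i : Fin m, a i.succ k ^ r
      ≤ ∑' k, a 0 k ^ r * ∏ i : Fin m, (∑' k, a i.succ k) ^ r := by
        gcongr with k i
        exact ENNReal.le_tsum k
    _ ≤ _ := by
        rw [ENNReal.tsum_mul_right]
        gcongr
        exact ENNReal.tsum_rpow_le_rpow_tsum _ hr

/-- Only harmonicity is required of the functions: the estimate takes place in `[0, ∞]`, with no
finiteness of the Bergman norms. -/
theorem multiNorm_le_of_measure_le {m : ℕ} (hm : 1 ≤ m)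
    {ζ : ℕ → EuclideanSpace ℝ (Fin (n + 1))} {l : ℕ → ℝ} (hW : IsWhitneyDecomposition ζ l)
    {p q s : ℝ} (hp : 0 < p) (hq : 0 < q) (hs : 0 < s) (hsq : s ≤ q) (β : Fin m → ℝ)
    {μ : Measure (EuclideanSpace ℝ (Fin (n + 1)))} {C : ℝ≥0}
    (hC : ∀ k, μ (closedCube (ζ k) (l k)) ≤
      C * ENNReal.ofReal ((ζ k (Fin.last n)) ^ (∑ i, p * (n + 1 + β i) / s))) :
    ∃ C : ℝ≥0, ∀ f : Fin m → EuclideanSpace ℝ (Fin (n + 1)) → 𝕜,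
      (∀ i, HarmonicOnNhd (f i) (upperHalfSpace n)) →
        multiNorm ζ l p q μ f ≤ C * ∏ i, bergmanNorm s (β i) (f i) := by
  obtain ⟨δ, hδ, hδW⟩ := hW.exists_comparable
  obtain ⟨N, hN⟩ := hW.exists_tsum_indicator_le hδ fun k => (hδW k).2
  choose K hK using fun i => exists_enorm_rpow_le_setLIntegral_cubeNhd n 𝕜 hs hδ (β i)
  set D : ℝ≥0∞ := ((C : ℝ≥0∞) ^ (q / p) *
    ∏ i, ((K i : ℝ≥0∞) ^ (q / s) * (N : ℝ≥0∞) ^ (q / s))) ^ (1 / q)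
  have hD : D ≠ ⊤ := by
    refine ENNReal.rpow_ne_top_of_nonneg (by positivity) (ENNReal.mul_ne_top ?_ ?_)
    · exact ENNReal.rpow_ne_top_of_nonneg (by positivity) ENNReal.coe_ne_top
    · exact ENNReal.prod_ne_top fun i _ => ENNReal.mul_ne_top
        (ENNReal.rpow_ne_top_of_nonneg (by positivity) ENNReal.coe_ne_top)
        (ENNReal.rpow_ne_top_of_nonneg (by positivity) ENNReal.coe_ne_top)
  refine ⟨D.toNNReal, fun f hf => ?_⟩
  rw [ENNReal.coe_toNNReal hD]
  set a : Fin m → ℕ → ℝ≥0∞ := fun i k =>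
    ∫⁻ w in cubeNhd δ (ζ k), ‖f i w‖ₑ ^ s * ENNReal.ofReal (w (Fin.last n) ^ β i)
  have ha : ∀ i, ∑' k, a i k ≤ N * bergmanNorm s (β i) (f i) ^ s := fun i => by
    rw [bergmanNorm_rpow hs]
    exact tsum_setLIntegral_le_mul _ (fun k => (isClosed_cubeNhd δ (ζ k)).measurableSet)
      (fun k => cubeNhd_subset_upperHalfSpace hδ (hW.center_pos k)) hN
  have hpoint : ∀ i k, ∀ z ∈ closedCube (ζ k) (l k), ‖f i z‖ₑ ^ p ≤
      (K i : ℝ≥0∞) ^ (p / s) * a i k ^ (p / s) *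
        ENNReal.ofReal (ζ k (Fin.last n) ^ (-(p * (n + 1 + β i) / s))) := by
    intro i k z hz
    have hη := hW.center_pos k
    have h1 := hK i (f i) (ζ k) z (hf i) hη
      (fun j => (hz j).trans (hW.half_side_lt k).le)
      (by linarith [(abs_le.1 (hz (Fin.last n))).1, (hδW k).1])
    have h2 : ‖f i z‖ₑ ^ p = (‖f i z‖ₑ ^ s) ^ (p / s) := by
      rw [← ENNReal.rpow_mul, mul_div_cancel₀ _ hs.ne']
    rw [h2]
    refine (ENNReal.rpow_le_rpow h1 (by positivity)).trans_eq ?_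
    rw [ENNReal.mul_rpow_of_nonneg _ _ (by positivity),
      ENNReal.mul_rpow_of_nonneg _ _ (by positivity), mul_right_comm,
      ENNReal.ofReal_rpow_of_nonneg (by positivity) (by positivity), ← Real.rpow_mul hη.le]
    congr 4
    ring
  have hcube : ∀ k, ∫⁻ z in closedCube (ζ k) (l k), ∏ i, ‖f i z‖ₑ ^ p ∂μ ≤
      C * ∏ i, ((K i : ℝ≥0∞) ^ (p / s) * a i k ^ (p / s)) := by
    intro k
    have hη := hW.center_pos k
    calc ∫⁻ z in closedCube (ζ k) (l k), ∏ i, ‖f i z‖ₑ ^ p ∂μ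
        ≤ ∫⁻ _ in closedCube (ζ k) (l k), ∏ i, ((K i : ℝ≥0∞) ^ (p / s) * a i k ^ (p / s) *
        ENNReal.ofReal (ζ k (Fin.last n) ^ (-(p * (n + 1 + β i) / s)))) ∂μ :=
          setLIntegral_mono' isClosed_closedCube.measurableSet fun z hz =>
            Finset.prod_le_prod' fun i _ => hpoint i k z hz
      _ ≤ (∏ i, ((K i : ℝ≥0∞) ^ (p / s) * a i k ^ (p / s) *
        ENNReal.ofReal (ζ k (Fin.last n) ^ (-(p * (n + 1 + β i) / s))))) *
          (C * ENNReal.ofReal ((ζ k (Fin.last n)) ^ (∑ i, p * (n + 1 + β i) / s))) := by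
          rw [setLIntegral_const]
          gcongr
          exact hC k
      _ = C * (∏ i, ((K i : ℝ≥0∞) ^ (p / s) * a i k ^ (p / s))) *
          ((∏ i, ENNReal.ofReal (ζ k (Fin.last n) ^ (-(p * (n + 1 + β i) / s)))) *
          ENNReal.ofReal ((ζ k (Fin.last n)) ^ (∑ i, p * (n + 1 + β i) / s))) := by
          rw [Finset.prod_mul_distrib]
          ring
      _ = _ := by
          rw [Real.rpow_sum_of_pos hη, ENNReal.ofReal_prod_of_nonneg (fun i _ => by positivity),
            ← Finset.prod_mul_distrib]
          -- The heights cancel factor by factor; this fixes the exponent in the measure condition.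
          have : ∀ i, ENNReal.ofReal (ζ k (Fin.last n) ^ (-(p * (n + 1 + β i) / s))) *
              ENNReal.ofReal (ζ k (Fin.last n) ^ (p * (n + 1 + β i) / s)) = 1 := fun i => by
            rw [← ENNReal.ofReal_mul (by positivity), ← Real.rpow_add hη, neg_add_cancel,
              Real.rpow_zero, ENNReal.ofReal_one]
          simp [this]
  have hexp : ∀ x : ℝ≥0∞, (x ^ (p / s)) ^ (q / p) = x ^ (q / s) := fun x => by
    rw [← ENNReal.rpow_mul]
    congr 1
    field_simp
  have hsum : ∑' k, (∫⁻ z in closedCube (ζ k) (l k), ∏ i, ‖f i z‖ₑ ^ p ∂μ) ^ (q / p) ≤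
      (C : ℝ≥0∞) ^ (q / p) * (∏ i, (K i : ℝ≥0∞) ^ (q / s)) * ∏ i, (∑' k, a i k) ^ (q / s) := by
    -- The hypothesis `s ≤ q` enters here, as `1 ≤ q / s`.
    refine le_trans ?_ (mul_le_mul_right (ENNReal.tsum_prod_rpow_le hm a
      ((one_le_div hs).2 hsq)) _)
    rw [← ENNReal.tsum_mul_left]
    refine ENNReal.tsum_le_tsum fun k => ?_
    refine (ENNReal.rpow_le_rpow (hcube k) (by positivity)).trans_eq ?_
    rw [ENNReal.mul_rpow_of_nonneg _ _ (by positivity),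
      ← ENNReal.prod_rpow_of_nonneg (by positivity)]
    simp_rw [ENNReal.mul_rpow_of_nonneg _ _ (show 0 ≤ q / p by positivity), hexp]
    rw [Finset.prod_mul_distrib, mul_assoc]
  have hfin : ∑' k, (∫⁻ z in closedCube (ζ k) (l k), ∏ i, ‖f i z‖ₑ ^ p ∂μ) ^ (q / p) ≤
      (C : ℝ≥0∞) ^ (q / p) * (∏ i, ((K i : ℝ≥0∞) ^ (q / s) * (N : ℝ≥0∞) ^ (q / s))) *
        (∏ i, bergmanNorm s (β i) (f i)) ^ q := by
    refine hsum.trans ?_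
    calc _ ≤ (C : ℝ≥0∞) ^ (q / p) * (∏ i, (K i : ℝ≥0∞) ^ (q / s)) *
          ∏ i, (N * bergmanNorm s (β i) (f i) ^ s) ^ (q / s) := by
          gcongr with i
          exact ha i
      _ = _ := by
          simp_rw [ENNReal.mul_rpow_of_nonneg _ _ (show 0 ≤ q / s by positivity),
            ← ENNReal.rpow_mul, mul_div_cancel₀ _ hs.ne']
          rw [Finset.prod_mul_distrib, Finset.prod_mul_distrib,
            ENNReal.prod_rpow_of_nonneg hq.le]
          ring
  rw [multiNorm]
  refine (ENNReal.rpow_le_rpow hfin (by positivity)).trans_eq ?_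
  rw [ENNReal.mul_rpow_of_nonneg _ _ (by positivity), ← ENNReal.rpow_mul (∏ i, _),
    mul_one_div_cancel hq.ne', ENNReal.rpow_one]

end Sufficiency

/-! ### Harmonicity of Kelvin transforms of powers of isotropic forms -/

section KelvinTransform

open InnerProductSpace Laplacian Topology

variable {E : Type*} [NormedAddCommGroup E] [InnerProductSpace ℝ E]

lemma hasFDerivAt_norm_sub_sq_rpow {w z : E} (hz : z ≠ w) (γ : ℝ) :
    HasFDerivAt (fun z => (((‖z - w‖ ^ 2) ^ γ : ℝ) : ℂ))
      (Complex.ofRealCLM.comp ((2 * γ * (‖z - w‖ ^ 2) ^ (γ - 1)) • innerSL ℝ (z - w))) z := by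
  refine Complex.ofRealCLM.hasFDerivAt.comp z ?_
  have h1 : HasFDerivAt (fun z : E => ‖z - w‖ ^ 2) (2 • innerSL ℝ (z - w)) z := by
    have := ((hasStrictFDerivAt_norm_sq (z - w)).hasFDerivAt).comp z
      ((hasFDerivAt_id (𝕜 := ℝ) z).sub_const w)
    exact this.congr_fderiv (by ext v; simp)
  have h2 : ‖z - w‖ ^ 2 ≠ 0 := pow_ne_zero 2 (norm_ne_zero_iff.2 (sub_ne_zero.2 hz))
  refine ((Real.hasDerivAt_rpow_const (Or.inl h2)).comp_hasFDerivAt z h1).congr_fderiv ?_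
  ext v
  simp
  ring

lemma hasFDerivAt_clm_sub_pow (L : E →L[ℝ] ℂ) (w z : E) (k : ℕ) :
    HasFDerivAt (fun z => L (z - w) ^ (k + 1)) (((k + 1 : ℂ) * L (z - w) ^ k) • L) z := by
  have h := (L.hasFDerivAt.comp z ((hasFDerivAt_id (𝕜 := ℝ) z).sub_const w)).pow (k + 1)
  refine HasFDerivAt.congr_fderiv h ?_
  ext v
  simp

variable [FiniteDimensional ℝ E]

/-- Products of powers of the distance to `w` with powers of an isotropic linear form are harmonic,
when the exponents match those of the Kelvin transform. -/
theorem harmonicAt_norm_rpow_mul_pow {ι : Type*} [Fintype ι] (b : OrthonormalBasis ι ℝ E)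
    {L : E →L[ℝ] ℂ} (hL : ∑ i, L (b i) ^ 2 = 0) {γ : ℝ} {k : ℕ}
    (hγ : 2 * γ = 2 - Fintype.card ι - 2 * (k + 2)) {w z : E} (hz : z ≠ w) :
    HarmonicAt (fun z => (((‖z - w‖ ^ 2) ^ γ : ℝ) : ℂ) * L (z - w) ^ (k + 2)) z := by
  have hC : ∀ z, z ≠ w →
      ContDiffAt ℝ 2 (fun z => (((‖z - w‖ ^ 2) ^ γ : ℝ) : ℂ) * L (z - w) ^ (k + 2)) z := by
    intro z hz
    have h2 : ‖z - w‖ ^ 2 ≠ 0 := pow_ne_zero 2 (norm_ne_zero_iff.2 (sub_ne_zero.2 hz))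
    refine ContDiffAt.mul ?_ ?_
    · refine Complex.ofRealCLM.contDiff.contDiffAt.comp z ?_
      exact ContDiffAt.rpow_const_of_ne (((contDiff_norm_sq ℝ).comp
        (contDiff_id.sub contDiff_const)).contDiffAt) h2
    · exact ((L.contDiff.comp (contDiff_id.sub contDiff_const)).pow _).contDiffAt
  have hne : ∀ᶠ y in 𝓝 z, y ≠ w := isOpen_ne.mem_nhds hz
  refine ⟨hC z hz, ?_⟩
  filter_upwards [hne] with z hz
  have hne : ∀ᶠ y in 𝓝 z, y ≠ w := isOpen_ne.mem_nhds hz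
  rw [laplacian_eq_iteratedFDeriv_orthonormalBasis _ b]
  -- The four terms are grouped for summation over the orthonormal basis: the first vanishes by
  -- isotropy of `L`, and the sums in the others are `L (z - w)`, `‖z - w‖²` and the dimension.
  have hsecond : ∀ v : E, iteratedFDeriv ℝ 2
      (fun z => (((‖z - w‖ ^ 2) ^ γ : ℝ) : ℂ) * L (z - w) ^ (k + 2)) z ![v, v] =
      (((‖z - w‖ ^ 2) ^ γ : ℝ) : ℂ) * ((k + 2) * (k + 1)) * L (z - w) ^ k * L v ^ 2 +
      (4 * γ * (k + 2) * ((‖z - w‖ ^ 2) ^ (γ - 1) : ℝ) * L (z - w) ^ (k + 1)) *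
        ((inner ℝ (z - w) v : ℝ) * L v) +
      (4 * γ * (γ - 1) * ((‖z - w‖ ^ 2) ^ (γ - 2) : ℝ) * L (z - w) ^ (k + 2)) *
        ((inner ℝ (z - w) v : ℝ) * (inner ℝ v (z - w) : ℝ)) +
      (2 * γ * ((‖z - w‖ ^ 2) ^ (γ - 1) : ℝ) * L (z - w) ^ (k + 2)) * (inner ℝ v v : ℝ) := by
    intro v
    have hfd : DifferentiableAt ℝ (fderiv ℝ
        (fun z => (((‖z - w‖ ^ 2) ^ γ : ℝ) : ℂ) * L (z - w) ^ (k + 2))) z :=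
      ((hC z hz).fderiv_right (m := 1) (by norm_num)).differentiableAt (by norm_num)
    have hfirst : (fun y => fderiv ℝ
        (fun z => (((‖z - w‖ ^ 2) ^ γ : ℝ) : ℂ) * L (z - w) ^ (k + 2)) y v) =ᶠ[𝓝 z]
        fun y => (((‖y - w‖ ^ 2) ^ γ : ℝ) : ℂ) * (L (y - w) ^ (k + 1)) * ((k + 2) * L v) +
          (((‖y - w‖ ^ 2) ^ (γ - 1) : ℝ) : ℂ) * L (y - w) ^ (k + 2) *
            (2 * γ * (inner ℝ v (y - w) : ℝ)) := by
      filter_upwards [hne] with y hy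
      rw [((hasFDerivAt_norm_sub_sq_rpow hy γ).fun_mul
        (hasFDerivAt_clm_sub_pow L w y (k + 1))).fderiv]
      simp [-map_sub, real_inner_comm v]
      ring
    have hinner : HasFDerivAt (fun y => ((inner ℝ v (y - w) : ℝ) : ℂ))
        (Complex.ofRealCLM.comp (innerSL ℝ v)) z :=
      Complex.ofRealCLM.hasFDerivAt.comp z
        ((innerSL ℝ v).hasFDerivAt.comp z ((hasFDerivAt_id (𝕜 := ℝ) z).sub_const w))
    have hD := (((hasFDerivAt_norm_sub_sq_rpow hz γ).fun_mul
        (hasFDerivAt_clm_sub_pow L w z k)).mul_const ((k + 2) * L v)).fun_add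
      (((hasFDerivAt_norm_sub_sq_rpow hz (γ - 1)).fun_mul
        (hasFDerivAt_clm_sub_pow L w z (k + 1))).fun_mul (hinner.const_mul (2 * (γ : ℂ))))
    rw [iteratedFDeriv_two_apply]
    have h3 : fderiv ℝ (fderiv ℝ
        (fun z => (((‖z - w‖ ^ 2) ^ γ : ℝ) : ℂ) * L (z - w) ^ (k + 2))) z v v =
        fderiv ℝ (fun y => fderiv ℝ
        (fun z => (((‖z - w‖ ^ 2) ^ γ : ℝ) : ℂ) * L (z - w) ^ (k + 2)) y v) z v := by
      rw [(hfd.hasFDerivAt.clm_apply (hasFDerivAt_const v z)).fderiv]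
      simp
    simp only [Matrix.cons_val_zero, Matrix.cons_val_one]
    rw [h3, hfirst.fderiv_eq, HasFDerivAt.fderiv hD, show γ - 1 - 1 = γ - 2 by ring]
    simp [-map_sub, real_inner_comm v]
    ring
  simp only [hsecond, Pi.zero_apply]
  simp only [Finset.sum_add_distrib, ← Finset.mul_sum]
  rw [hL]
  have hLz : ∑ i, ((inner ℝ (z - w) (b i) : ℝ) : ℂ) * L (b i) = L (z - w) := by
    conv_rhs => rw [← b.sum_repr' (z - w)]
    rw [map_sum]
    refine Finset.sum_congr rfl fun i _ => ?_
    rw [map_smul, Complex.real_smul, real_inner_comm]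
  have hnorm : ∑ i, (((inner ℝ (z - w) (b i) : ℝ) : ℂ) * (inner ℝ (b i) (z - w) : ℝ)) =
      ((‖z - w‖ ^ 2 : ℝ) : ℂ) := by
    rw [← real_inner_self_eq_norm_sq, ← b.sum_inner_mul_inner (z - w) (z - w)]
    push_cast
    rfl
  have hcard : ∑ i, ((inner ℝ (b i) (b i) : ℝ) : ℂ) = Fintype.card ι := by
    simp
  rw [hLz, hnorm, hcard]
  have hpos : 0 < ‖z - w‖ ^ 2 := pow_pos (norm_pos_iff.2 (sub_ne_zero.2 hz)) 2
  have hshift : (‖z - w‖ ^ 2) ^ (γ - 1) = (‖z - w‖ ^ 2) ^ (γ - 2) * ‖z - w‖ ^ 2 := by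
    rw [← Real.rpow_add_one hpos.ne']
    congr 1
    ring
  rw [hshift]
  have hγ' : (2 * γ : ℂ) = 2 - Fintype.card ι - 2 * (k + 2) := by exact_mod_cast hγ
  push_cast
  -- With `d` the dimension, the Laplacian is a multiple of `2γ (2γ + d - 2 + 2(k + 2))`, whose last
  -- factor is zero by the choice of `γ`.
  linear_combination (2 * γ * ((‖z - w‖ ^ 2 : ℂ) * ((‖z - w‖ ^ 2) ^ (γ - 2) : ℝ)) *
    L (z - w) ^ (k + 2)) * hγ'

end KelvinTransform

/-! ### Integrability of the model decay against the weight -/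

section WeightIntegral

open Set

/-- Near zero `t^β` is integrable since `β > -1`; at infinity the integrand is at most `t^(β - r)`
with `β - r < -1`. -/
lemma integrableOn_one_add_rpow_mul_rpow {r β : ℝ} (hβ : -1 < β) (hr : 1 + β < r) :
    IntegrableOn (fun t : ℝ => (1 + |t|) ^ (-r) * t ^ β) (Ioi 0) := by
  have hm : Measurable fun t : ℝ => (1 + |t|) ^ (-r) * t ^ β := by fun_prop
  rw [← Ioc_union_Ioi_eq_Ioi (zero_le_one' ℝ)]
  refine IntegrableOn.union ?_ ?_
  · have h := (intervalIntegral.intervalIntegrable_rpow' (a := 0) (b := 1) hβ)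
    rw [intervalIntegrable_iff_integrableOn_Ioc_of_le zero_le_one] at h
    refine h.mono' hm.aestronglyMeasurable ((ae_restrict_mem measurableSet_Ioc).mono fun t ht => ?_)
    have ht0 := ht.1
    rw [Real.norm_of_nonneg (by positivity)]
    exact mul_le_of_le_one_left (by positivity)
      (Real.rpow_le_one_of_one_le_of_nonpos (by linarith [abs_nonneg t]) (by linarith))
  · have h := integrableOn_Ioi_rpow_of_lt (a := -r + β) (c := 1) (by linarith) one_pos
    refine h.mono' hm.aestronglyMeasurable ((ae_restrict_mem measurableSet_Ioi).mono fun t ht => ?_)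
    have ht0 : 0 < t := one_pos.trans ht
    rw [Real.norm_of_nonneg (by positivity), Real.rpow_add ht0]
    exact mul_le_mul_of_nonneg_right
      (Real.rpow_le_rpow_of_nonpos ht0 (by linarith [le_abs_self t]) (by linarith)) (by positivity)

/-- Since `|z_i| ≤ ‖z‖` for each of the `n + 1` coordinates, the decay factor is at most the product
of `(1 + |z_i|)^(-r)`. The integral is then dominated by a product of one-dimensional ones. -/
lemma lintegral_one_add_norm_rpow_mul_height_rpow_lt_top {n : ℕ} {r β : ℝ} (hβ : -1 < β)
    (hr1 : 1 < r) (hr : 1 + β < r) :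
    ∫⁻ z in upperHalfSpace n, ENNReal.ofReal ((1 + ‖z‖) ^ (-((n + 1) * r)) *
      z (Fin.last n) ^ β) < ∞ := by
  set f : Fin (n + 1) → ℝ → ℝ := fun i =>
    if i = Fin.last n then (Ioi 0).indicator fun t : ℝ => (1 + |t|) ^ (-r) * t ^ β
    else fun t : ℝ => (1 + |t|) ^ (-r)
  have hf : ∀ i, Integrable (f i) volume := by
    intro i
    by_cases hi : i = Fin.last n
    · simp only [f, if_pos hi]
      exact (integrable_indicator_iff measurableSet_Ioi).2
        (integrableOn_one_add_rpow_mul_rpow hβ hr)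
    · simp only [f, if_neg hi]
      exact integrable_one_add_norm (E := ℝ) (by simpa using hr1)
  have hprod := Integrable.fintype_prod hf
  rw [← volume_pi] at hprod
  have hE := (EuclideanSpace.volume_preserving_symm_measurableEquiv_toLp
    (Fin (n + 1))).integrable_comp_of_integrable hprod
  refine lt_of_le_of_lt ?_ hE.lintegral_lt_top
  rw [← lintegral_indicator isOpen_upperHalfSpace.measurableSet]
  refine lintegral_mono fun z => ?_
  by_cases hz : z ∈ upperHalfSpace n
  · rw [indicator_of_mem hz]
    refine ENNReal.ofReal_le_ofReal ?_
    have hz0 : 0 < z (Fin.last n) := hz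
    simp only [Function.comp_apply, MeasurableEquiv.coe_toLp_symm]
    have h1 : ∀ i, f i (z i) =
        (1 + |z i|) ^ (-r) * if i = Fin.last n then z (Fin.last n) ^ β else 1 := by
      intro i
      by_cases hi : i = Fin.last n
      · subst hi
        simp [f, hz0]
      · simp [f, hi]
    simp_rw [h1]
    rw [Finset.prod_mul_distrib, Finset.prod_ite_eq' Finset.univ (Fin.last n)]
    simp only [Finset.mem_univ, if_true]
    gcongr
    calc (1 + ‖z‖) ^ (-((n + 1) * r)) = ∏ _i : Fin (n + 1), (1 + ‖z‖) ^ (-r) := by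
          rw [Finset.prod_const, Finset.card_univ, Fintype.card_fin, ← Real.rpow_natCast,
            ← Real.rpow_mul (by positivity)]
          congr 1
          push_cast
          ring
      _ ≤ _ := by
          refine Finset.prod_le_prod (fun i _ => by positivity) fun i _ => ?_
          refine Real.rpow_le_rpow_of_nonpos (by positivity) ?_ (by linarith)
          have := PiLp.norm_apply_le z i
          rw [Real.norm_eq_abs] at this
          linarith
  · rw [indicator_of_notMem hz]
    exact zero_le

end WeightIntegral

/-! ### Test functions adapted to a cube -/

section TestFunctions

open InnerProductSpace Topology

variable {n : ℕ} {𝕜 : Type*} [RCLike 𝕜]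

variable (n) in
/-- The linear form `(x, t) ↦ t + i x₁`. -/
noncomputable def heightForm : EuclideanSpace ℝ (Fin (n + 1)) →L[ℝ] ℂ :=
  Complex.ofRealCLM.comp (EuclideanSpace.proj (Fin.last n)) +
    (Complex.I : ℂ) • Complex.ofRealCLM.comp (EuclideanSpace.proj 0)

lemma heightForm_apply (z : EuclideanSpace ℝ (Fin (n + 1))) :
    heightForm n z = z (Fin.last n) + z 0 * Complex.I := by
  simp [heightForm, mul_comm]

lemma zero_ne_last (hn : 1 ≤ n) : (0 : Fin (n + 1)) ≠ Fin.last n := by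
  intro h
  have := congrArg Fin.val h
  simp at this
  omega

/-- This is `1 + i² = 0`. It needs `n ≥ 1`: otherwise the coordinates `0` and `Fin.last n` coincide.
-/
lemma sum_heightForm_basisFun_sq (hn : 1 ≤ n) :
    ∑ i, heightForm n (EuclideanSpace.basisFun (Fin (n + 1)) ℝ i) ^ 2 = 0 := by
  have h := zero_ne_last hn
  have : ∀ i, heightForm n (EuclideanSpace.basisFun (Fin (n + 1)) ℝ i) ^ 2 =
      (if i = Fin.last n then 1 else 0) - if i = 0 then 1 else 0 := by
    intro i
    rw [heightForm_apply]
    by_cases h1 : i = Fin.last n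
    · subst h1
      simp [h, h.symm]
    · by_cases h2 : i = 0
      · subst h2
        simp [h, h.symm]
      · simp [h1, h2, Ne.symm h1, Ne.symm h2]
  simp_rw [this]
  simp

lemma norm_heightForm_le (hn : 1 ≤ n) (z : EuclideanSpace ℝ (Fin (n + 1))) :
    ‖heightForm n z‖ ≤ ‖z‖ := by
  refine abs_le_of_sq_le_sq' ?_ (norm_nonneg _) |>.2
  rw [EuclideanSpace.real_norm_sq_eq, Complex.sq_norm, heightForm_apply,
    Complex.normSq_add_mul_I, ← Finset.sum_pair (f := fun i => z i ^ 2) (zero_ne_last hn).symm]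
  exact Finset.sum_le_sum_of_subset_of_nonneg (Finset.subset_univ _) fun _ _ _ => sq_nonneg _

/-- The Kelvin transform, with pole `w`, of the polynomial `(t + i x₁)^(k + 2)`. -/
noncomputable def kelvinPower (k : ℕ) (w z : EuclideanSpace ℝ (Fin (n + 1))) : ℂ :=
  (((‖z - w‖ ^ 2) ^ (-(n + 2 * k + 3) / 2 : ℝ) : ℝ) : ℂ) * heightForm n (z - w) ^ (k + 2)

lemma harmonicAt_kelvinPower (hn : 1 ≤ n) (k : ℕ) {w z : EuclideanSpace ℝ (Fin (n + 1))}
    (hz : z ≠ w) : HarmonicAt (kelvinPower k w) z := by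
  refine harmonicAt_norm_rpow_mul_pow (EuclideanSpace.basisFun (Fin (n + 1)) ℝ)
    (sum_heightForm_basisFun_sq hn) ?_ hz
  rw [Fintype.card_fin]
  push_cast
  ring

lemma norm_kelvinPower_le (hn : 1 ≤ n) (k : ℕ) {w z : EuclideanSpace ℝ (Fin (n + 1))}
    (hz : z ≠ w) : ‖kelvinPower k w z‖ ≤ ‖z - w‖ ^ (-(k + n + 1) : ℝ) := by
  have hpos : 0 < ‖z - w‖ := norm_pos_iff.2 (sub_ne_zero.2 hz)
  rw [kelvinPower, norm_mul, norm_pow, Complex.norm_real, Real.norm_of_nonneg (by positivity)]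
  calc _ ≤ (‖z - w‖ ^ 2) ^ (-(n + 2 * k + 3) / 2 : ℝ) * ‖z - w‖ ^ (k + 2) := by
        gcongr
        exact norm_heightForm_le hn _
    _ = _ := by
        rw [← Real.rpow_natCast ‖z - w‖ 2, ← Real.rpow_mul hpos.le, ← Real.rpow_natCast,
          ← Real.rpow_add hpos]
        congr 1
        push_cast
        ring

lemma exists_half_le_re_one_add_mul_I_pow (k : ℕ) :
    ∃ ε : ℝ, 0 < ε ∧ ∀ y : ℝ, |y| ≤ ε → 1 / 2 ≤ ((1 + y * Complex.I) ^ k).re := by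
  have hc : Continuous fun y : ℝ => ((1 + y * Complex.I) ^ k).re := by fun_prop
  have h1 : ∀ᶠ y : ℝ in 𝓝 0, 1 / 2 < ((1 + y * Complex.I) ^ k).re :=
    hc.continuousAt.eventually (lt_mem_nhds (by norm_num))
  obtain ⟨ε, hε, h⟩ := Metric.eventually_nhds_iff.1 h1
  refine ⟨ε / 2, by positivity, fun y hy => (h ?_).le⟩
  rw [Real.dist_eq, sub_zero]
  linarith

variable (n) in
/-- Far below a cube, the pole of the Kelvin transform sees the cube in a narrow cone around the
vertical direction, in which the real part is positive. -/
lemma exists_le_re_kelvinPower (hn : 1 ≤ n) (k : ℕ) :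
    ∃ a c₀ : ℝ, 1 ≤ a ∧ 0 < c₀ ∧ ∀ c z : EuclideanSpace ℝ (Fin (n + 1)), 0 < z (Fin.last n) →
      0 < c (Fin.last n) → (∀ i, |z i - c i| ≤ c (Fin.last n)) →
      c₀ * c (Fin.last n) ^ (-(k + n + 1) : ℝ) ≤
        (kelvinPower k (c - EuclideanSpace.single (Fin.last n) ((1 + a) * c (Fin.last n))) z).re := by
  obtain ⟨ε, hε, hre⟩ := exists_half_le_re_one_add_mul_I_pow (k + 2)
  -- The pole has height `-aη`, so from it the slope `|y 0| / y (Fin.last n)` of a point of the cube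
  -- is at most `1/a ≤ ε`. The bound `1 ≤ a` is kept for the norm estimate `half_one_add_norm_le`.
  set a := max 1 ε⁻¹
  have ha : 1 ≤ a := le_max_left _ _
  have ha0 : 0 < a := one_pos.trans_le ha
  have haε : a⁻¹ ≤ ε := inv_le_of_inv_le₀ hε (le_max_right _ _)
  -- Every coordinate of `z` relative to the pole is at most `(2 + a)η`, so the distance to the pole
  -- is at most `bη`.
  set b : ℝ := (n + 1) * (2 + a)
  have hb : 0 < b := by positivity
  refine ⟨a, (b ^ 2) ^ (-(n + 2 * k + 3) / 2 : ℝ) * (a ^ (k + 2) * (1 / 2)), ha, by positivity,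
    fun c z hz hc hzc => ?_⟩
  set η := c (Fin.last n)
  set y := z - (c - EuclideanSpace.single (Fin.last n) ((1 + a) * η))
  have hy : ∀ i, y i = z i - c i + if i = Fin.last n then (1 + a) * η else 0 := fun i => by
    simp only [y, PiLp.sub_apply, PiLp.single_apply]
    ring
  have hyn : y (Fin.last n) = z (Fin.last n) + a * η := by
    rw [hy, if_pos rfl]
    simp only [η]
    ring
  have hy0 : |y 0| ≤ η := by
    rw [hy, if_neg (zero_ne_last hn), add_zero]
    exact hzc 0
  have hylow : a * η ≤ y (Fin.last n) := by rw [hyn]; linarith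
  have hypos : 0 < y (Fin.last n) := lt_of_lt_of_le (by positivity) hylow
  have hynorm : ‖y‖ ≤ b * η := by
    refine (EuclideanSpace.norm_le_of_abs_le (c := (2 + a) * η) (by positivity) fun i => ?_).trans_eq
      (by simp only [b, Fintype.card_fin]; push_cast; ring)
    by_cases hi : i = Fin.last n
    · subst hi
      rw [abs_of_pos hypos, hyn]
      have := (abs_le.1 (hzc (Fin.last n))).2
      simp only [η] at this ⊢
      linarith
    · rw [hy, if_neg hi, add_zero]
      nlinarith [hzc i]
  have hynz : 0 < ‖y‖ := norm_pos_iff.2 fun h => by simp [h] at hypos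
  have hform : heightForm n y =
      (y (Fin.last n) : ℂ) * (1 + ((y 0 / y (Fin.last n) : ℝ) : ℂ) * Complex.I) := by
    rw [heightForm_apply]
    have : (y (Fin.last n) : ℂ) ≠ 0 := by exact_mod_cast hypos.ne'
    push_cast
    field_simp
  have hratio : |y 0 / y (Fin.last n)| ≤ ε := by
    refine le_trans ?_ haε
    rw [abs_div, abs_of_pos hypos, div_le_iff₀ hypos, ← div_eq_inv_mul, le_div_iff₀ ha0]
    nlinarith
  have hval : (kelvinPower k (c - EuclideanSpace.single (Fin.last n) ((1 + a) * η)) z).re =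
      (‖y‖ ^ 2) ^ (-(n + 2 * k + 3) / 2 : ℝ) * (y (Fin.last n) ^ (k + 2) *
        ((1 + ((y 0 / y (Fin.last n) : ℝ) : ℂ) * Complex.I) ^ (k + 2)).re) := by
    rw [kelvinPower, Complex.re_ofReal_mul]
    change _ * (heightForm n y ^ (k + 2)).re = _
    rw [hform, mul_pow, ← Complex.ofReal_pow, Complex.re_ofReal_mul]
  rw [hval]
  have hη : η ^ (-(k + n + 1) : ℝ) = (η ^ 2) ^ (-(n + 2 * k + 3) / 2 : ℝ) * η ^ (k + 2) := by
    rw [← Real.rpow_natCast η 2, ← Real.rpow_mul hc.le, ← Real.rpow_natCast,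
      ← Real.rpow_add hc]
    congr 1
    push_cast
    ring
  calc _ = ((b * η) ^ 2) ^ (-(n + 2 * k + 3) / 2 : ℝ) * ((a * η) ^ (k + 2) * (1 / 2)) := by
        rw [hη, mul_pow b, Real.mul_rpow (by positivity) (by positivity), mul_pow]
        ring
    _ ≤ _ := by
        refine mul_le_mul ?_ ?_ (by positivity) (by positivity)
        · refine Real.rpow_le_rpow_of_nonpos (by positivity) (by gcongr) ?_
          rw [div_nonpos_iff]
          right
          refine ⟨?_, by norm_num⟩
          have : (0 : ℝ) ≤ n + 2 * k + 3 := by positivity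
          linarith
        · exact mul_le_mul (by gcongr) (hre _ hratio) (by norm_num) (by positivity)

/-- In the expanded square the cross term is positive, so the right side squared is at least `1 +
‖z‖²`. -/
lemma half_one_add_norm_le {a : ℝ} (ha : 1 ≤ a) {z : EuclideanSpace ℝ (Fin (n + 1))}
    (hz : 0 < z (Fin.last n)) : (1 + ‖z‖) / 2 ≤ ‖z + EuclideanSpace.single (Fin.last n) a‖ := by
  refine abs_le_of_sq_le_sq' ?_ (norm_nonneg _) |>.2
  rw [norm_add_sq_real, EuclideanSpace.inner_single_right]
  simp only [conj_trivial, PiLp.norm_single, Real.norm_eq_abs, sq_abs]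
  nlinarith [sq_nonneg (‖z‖ - 1), mul_pos (one_pos.trans_le ha) hz]

variable (n 𝕜) in
/-- Every cube carries a harmonic function which is bounded below there and whose Bergman norm is
controlled by the power of the height dictated by scaling. -/
theorem exists_memBergman_one_le (hn : 1 ≤ n) {s β : ℝ} (hs : 0 < s) (hβ : -1 < β) :
    ∃ C : ℝ≥0, ∀ c : EuclideanSpace ℝ (Fin (n + 1)), 0 < c (Fin.last n) →
      ∃ f : EuclideanSpace ℝ (Fin (n + 1)) → 𝕜, MemBergman s β f ∧
        bergmanNorm s β f ≤ C * ENNReal.ofReal (c (Fin.last n) ^ ((n + 1 + β) / s)) ∧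
        ∀ z, 0 < z (Fin.last n) → (∀ i, |z i - c i| ≤ c (Fin.last n)) → 1 ≤ ‖f z‖ₑ := by
  -- Large enough for both horizontal (`r > 1`) and vertical (`r > 1 + β`) integrability.
  set r : ℝ := 2 + |β|
  have hr1 : 1 < r := by simp only [r]; linarith [abs_nonneg β]
  have hrβ : 1 + β < r := by simp only [r]; linarith [le_abs_self β]
  -- The degree is taken so large that the decay `κ` satisfies `κ s ≥ (n + 1) r`, however small `s`
  -- is.
  obtain ⟨k, hk⟩ := exists_nat_ge ((n + 1) * r / s)
  set κ : ℝ := k + n + 1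
  have hκ0 : 0 < κ := by positivity
  have hκ : (n + 1) * r ≤ κ * s := by
    rw [div_le_iff₀ hs] at hk
    refine hk.trans ?_
    gcongr
    simp only [κ]
    linarith [Nat.cast_nonneg (α := ℝ) n]
  obtain ⟨a, c₀, ha, hc₀, hlow⟩ := exists_le_re_kelvinPower n hn k
  have hI := lintegral_one_add_norm_rpow_mul_height_rpow_lt_top (n := n) hβ hr1 hrβ
  set I := ∫⁻ z in upperHalfSpace n, ENNReal.ofReal ((1 + ‖z‖) ^ (-((n + 1) * r)) *
      z (Fin.last n) ^ β)
  set D : ℝ := 2 ^ κ / c₀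
  have hD : 0 < D := by positivity
  have hfin : (ENNReal.ofReal (D ^ s) * I) ^ (1 / s) ≠ ⊤ :=
    ENNReal.rpow_ne_top_of_nonneg (by positivity) (ENNReal.mul_ne_top ENNReal.ofReal_ne_top hI.ne)
  refine ⟨((ENNReal.ofReal (D ^ s) * I) ^ (1 / s)).toNNReal, fun c hc => ?_⟩
  rw [ENNReal.coe_toNNReal hfin]
  set η := c (Fin.last n)
  set w := c - EuclideanSpace.single (Fin.last n) ((1 + a) * η)
  -- Normalises the lower bound `c₀ η^(-κ)` on the cube to `1`.
  set A : ℝ := η ^ κ / c₀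
  have hA : 0 < A := by positivity
  -- Taking the real part gives a test function that serves real and complex scalars alike.
  set f : EuclideanSpace ℝ (Fin (n + 1)) → 𝕜 :=
    ((RCLike.ofRealCLM (K := 𝕜)).comp (A • Complex.reCLM)) ∘ kelvinPower k w
  have hfn : ∀ z, ‖f z‖ = A * |(kelvinPower k w z).re| := fun z => by
    simp [f, abs_of_pos hA]
  have hne : ∀ z ∈ upperHalfSpace n, z ≠ w := by
    rintro z hz rfl
    have hz : 0 < w (Fin.last n) := hz
    have : w (Fin.last n) = - (a * η) := by
      simp [w, η]
      ring
    have h2 : 0 < a * η := by positivity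
    linarith
  have hharm : HarmonicOnNhd f (upperHalfSpace n) := fun z hz =>
    (harmonicAt_kelvinPower hn k (hne z hz)).comp_CLM _
  -- The projection of `c` to the boundary. The substitution `p + η • z` brings the cube to unit
  -- height; its Jacobian and the weight together give `η^(n+1+β)`.
  set p := c - EuclideanSpace.single (Fin.last n) η
  have hcoord : ∀ z : EuclideanSpace ℝ (Fin (n + 1)),
      (p + η • z) (Fin.last n) = η * z (Fin.last n) := fun z => by
    simp [p, η]
  have hmemH : ∀ z, p + η • z ∈ upperHalfSpace n ↔ z ∈ upperHalfSpace n := fun z => by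
    change 0 < (p + η • z) (Fin.last n) ↔ 0 < z (Fin.last n)
    rw [hcoord, mul_pos_iff_of_pos_left hc]
  have hbound : ∀ z ∈ upperHalfSpace n, ‖f (p + η • z)‖ ≤ D * (1 + ‖z‖) ^ (-κ) := by
    intro z hz
    have h1 := norm_kelvinPower_le hn k (hne _ ((hmemH z).2 hz))
    have h2 : p + η • z - w = η • (z + EuclideanSpace.single (Fin.last n) a) := by
      simp only [p, w]
      ext i
      simp only [PiLp.add_apply, PiLp.sub_apply, PiLp.smul_apply, PiLp.single_apply, smul_eq_mul]
      split_ifs <;> ring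
    have h3 : η * ((1 + ‖z‖) / 2) ≤ ‖p + η • z - w‖ := by
      rw [h2, norm_smul, Real.norm_of_nonneg hc.le]
      gcongr
      exact half_one_add_norm_le ha hz
    have h4 : |(kelvinPower k w (p + η • z)).re| ≤ (η * ((1 + ‖z‖) / 2)) ^ (-κ) :=
      (Complex.abs_re_le_norm _).trans (h1.trans
        (Real.rpow_le_rpow_of_nonpos (by positivity) h3 (by linarith)))
    rw [hfn]
    calc _ ≤ A * (η * ((1 + ‖z‖) / 2)) ^ (-κ) := by gcongr
      _ = D * (1 + ‖z‖) ^ (-κ) := by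
        rw [Real.mul_rpow hc.le (by positivity), Real.div_rpow (by positivity) (by norm_num),
          Real.rpow_neg hc.le, Real.rpow_neg (by norm_num : (0 : ℝ) ≤ 2)]
        simp only [A, D]
        field_simp
  have hint : ∫⁻ z in upperHalfSpace n, ‖f z‖ₑ ^ s * ENNReal.ofReal (z (Fin.last n) ^ β) ≤
      ENNReal.ofReal (η ^ (n + 1 + β)) * (ENNReal.ofReal (D ^ s) * I) := by
    have hsc := lintegral_comp_add_smul ((upperHalfSpace n).indicator fun z =>
      ‖f z‖ₑ ^ s * ENNReal.ofReal (z (Fin.last n) ^ β)) p hc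
    rw [finrank_euclideanSpace_fin, lintegral_indicator isOpen_upperHalfSpace.measurableSet] at hsc
    have hsc' : ∫⁻ z in upperHalfSpace n, ‖f z‖ₑ ^ s * ENNReal.ofReal (z (Fin.last n) ^ β) =
        ENNReal.ofReal (η ^ (n + 1)) * ∫⁻ z, (upperHalfSpace n).indicator (fun z =>
          ‖f z‖ₑ ^ s * ENNReal.ofReal (z (Fin.last n) ^ β)) (p + η • z) := by
      rw [hsc, ← mul_assoc, ← ENNReal.ofReal_mul (by positivity), mul_inv_cancel₀ (by positivity),
        ENNReal.ofReal_one, one_mul]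
    rw [hsc', Real.rpow_add hc, ENNReal.ofReal_mul (by positivity), mul_assoc]
    have hη : η ^ (n + 1 : ℝ) = η ^ (n + 1) := by exact_mod_cast Real.rpow_natCast η (n + 1)
    rw [hη]
    gcongr
    rw [← mul_assoc, ← ENNReal.ofReal_mul (by positivity),
      ← lintegral_const_mul' _ _ ENNReal.ofReal_ne_top,
      ← lintegral_indicator isOpen_upperHalfSpace.measurableSet]
    refine lintegral_mono fun z => ?_
    by_cases hz : z ∈ upperHalfSpace n
    · have hz0 : 0 < z (Fin.last n) := hz
      rw [Set.indicator_of_mem hz, Set.indicator_of_mem ((hmemH z).2 hz), hcoord, ← ofReal_norm,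
        ENNReal.ofReal_rpow_of_nonneg (norm_nonneg _) hs.le, ← ENNReal.ofReal_mul (by positivity),
        ← ENNReal.ofReal_mul (by positivity)]
      refine ENNReal.ofReal_le_ofReal ?_
      calc ‖f (p + η • z)‖ ^ s * (η * z (Fin.last n)) ^ β
          ≤ (D * (1 + ‖z‖) ^ (-κ)) ^ s * (η * z (Fin.last n)) ^ β := by
            gcongr
            exact hbound z hz
        _ = (η ^ β * D ^ s) * ((1 + ‖z‖) ^ (-(κ * s)) * z (Fin.last n) ^ β) := by
            rw [Real.mul_rpow hD.le (by positivity), Real.mul_rpow hc.le hz0.le,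
              ← Real.rpow_mul (by positivity), neg_mul]
            ring
        _ ≤ _ := by
            gcongr
            linarith [norm_nonneg z]
    · rw [Set.indicator_of_notMem hz, Set.indicator_of_notMem fun h => hz ((hmemH z).1 h)]
  have hnorm : bergmanNorm s β f ≤ (ENNReal.ofReal (D ^ s) * I) ^ (1 / s) *
      ENNReal.ofReal (η ^ ((n + 1 + β) / s)) := by
    refine (ENNReal.rpow_le_rpow hint (by positivity)).trans_eq ?_
    rw [ENNReal.mul_rpow_of_nonneg _ _ (by positivity),
      ENNReal.ofReal_rpow_of_nonneg (by positivity) (by positivity), ← Real.rpow_mul hc.le,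
      mul_one_div, mul_comm]
  refine ⟨f, ⟨hharm, hnorm.trans_lt
    (ENNReal.mul_lt_top hfin.lt_top ENNReal.ofReal_lt_top)⟩, hnorm, fun z hz hzc => ?_⟩
  rw [← ofReal_norm, ENNReal.one_le_ofReal, hfn]
  have h1 := hlow c z hz hc hzc
  calc (1 : ℝ) = A * (c₀ * η ^ (-κ)) := by
        rw [Real.rpow_neg hc.le]
        simp only [A]
        field_simp
    _ ≤ A * |(kelvinPower k w z).re| := by
        gcongr
        exact h1.trans (le_abs_self _)

end TestFunctions

/-! ### The equivalence -/

theorem theorem2 {𝕜 : Type*} [RCLike 𝕜] (n m : ℕ) (hn : 1 ≤ n) (hm : 1 ≤ m)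
    (ζ : ℕ → EuclideanSpace ℝ (Fin (n + 1))) (l : ℕ → ℝ) (hW : IsWhitneyDecomposition ζ l)
    (p q s : ℝ) (hp : 0 < p) (hq : 0 < q) (hs : 0 < s) (hsq : s ≤ q)
    (β : Fin m → ℝ) (hβ : ∀ i, -1 < β i)
    (μ : Measure (EuclideanSpace ℝ (Fin (n + 1)))) :
    (∃ C : ℝ≥0, ∀ f : Fin m → EuclideanSpace ℝ (Fin (n + 1)) → 𝕜,
        (∀ i, MemBergman s (β i) (f i)) →
          multiNorm ζ l p q μ f ≤ C * ∏ i, bergmanNorm s (β i) (f i)) ↔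
      ∃ C : ℝ≥0, ∀ k, μ (closedCube (ζ k) (l k)) ≤
        C * ENNReal.ofReal ((ζ k (Fin.last n)) ^ (∑ i, p * (n + 1 + β i) / s)) := by
  constructor
  · rintro ⟨C, hC⟩
    choose B hB using fun i => exists_memBergman_one_le n 𝕜 hn hs (hβ i)
    refine ⟨(C * ∏ i, B i) ^ p, fun k => ?_⟩
    have hη := hW.center_pos k
    choose f hf hfB hf1 using fun i => hB i (ζ k) hη
    -- The test functions have modulus at least one on the `k`-th cube, and the other terms of the
    -- sum are discarded.
    have hlower : μ (closedCube (ζ k) (l k)) ^ (1 / p) ≤ multiNorm ζ l p q μ f := by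
      have h1 : μ (closedCube (ζ k) (l k)) ≤
          ∫⁻ z in closedCube (ζ k) (l k), ∏ i, ‖f i z‖ₑ ^ p ∂μ := by
        rw [← setLIntegral_one]
        refine setLIntegral_mono' isClosed_closedCube.measurableSet fun z hz => ?_
        exact Finset.one_le_prod' fun i _ => ENNReal.one_le_rpow
          (hf1 i z (hW.closedCube_subset k hz) fun j => (hz j).trans (hW.half_side_lt k).le) hp
      calc μ (closedCube (ζ k) (l k)) ^ (1 / p)
          = (μ (closedCube (ζ k) (l k)) ^ (q / p)) ^ (1 / q) := by
            rw [← ENNReal.rpow_mul]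
            congr 1
            field_simp
        _ ≤ multiNorm ζ l p q μ f := by
            rw [multiNorm]
            gcongr
            exact (ENNReal.rpow_le_rpow h1 (by positivity)).trans (ENNReal.le_tsum k)
    have hupper := hlower.trans (hC f hf)
    have h2 := ENNReal.rpow_le_rpow hupper hp.le
    rw [← ENNReal.rpow_mul, one_div_mul_cancel hp.ne', ENNReal.rpow_one] at h2
    refine h2.trans ?_
    calc ((C : ℝ≥0∞) * ∏ i, bergmanNorm s (β i) (f i)) ^ p
        ≤ ((C : ℝ≥0∞) * ∏ i, (B i *
          ENNReal.ofReal (ζ k (Fin.last n) ^ ((n + 1 + β i) / s)))) ^ p := by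
          gcongr with i
          exact hfB i
      _ = _ := by
          rw [Finset.prod_mul_distrib, ← mul_assoc, ENNReal.mul_rpow_of_nonneg _ _ hp.le,
            ENNReal.coe_rpow_of_nonneg _ hp.le, ← ENNReal.ofReal_prod_of_nonneg
              (fun i _ => by positivity), ← Real.rpow_sum_of_pos hη,
            ENNReal.ofReal_rpow_of_nonneg (by positivity) hp.le, ← Real.rpow_mul hη.le,
            Finset.sum_mul]
          push_cast
          congr 4
          funext i
          ring
  · rintro ⟨C, hC⟩
    obtain ⟨C', hC'⟩ := multiNorm_le_of_measure_le (𝕜 := 𝕜) hm hW hp hq hs hsq β hC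
    exact ⟨C', fun f hf => hC' f fun i => (hf i).1⟩
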